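/- Let $W(t)=\sum_{\ell\in\mathbb N}\beta_\ell(t)e_\ell$ be a complex-valued standard cylindrical Wiener process on a probability space $(\Omega,\mathcal A,\mathbb P)$: $\{e_\ell\}_{\ell\in\mathbb N}$ is an orthonormal basis of $L^2(\mathbb R,\mathbb C)$ and $\{\beta_\ell\}_{\ell\in\mathbb N}$ are i.i.d. standard $\mathbb C$-valued Brownian motions ($\mathbb E\beta_\ell(t)^2=0$, $\mathbb E|\beta_\ell(t)|^2=t$). Let $T>0$, let $f:[0,T]\times\mathbb R\to\mathbb C$ be measurable, put $H_\tau=\mathcal F^{-1}f(\tau,\cdot)$, that is $H_\tau(x)=\frac1{2\pi}\int_{\mathbb R}f(\tau,k)e^{ikx}\,dk$ (in the $L^2$ sense), and define the stochastic convolution $$\Phi(t,x)=\int_0^t H_{t-\tau}*dW(\tau)\,(x)=\sum_{\ell\in\mathbb N}\int_0^t\int_{\mathbb R}H_{t-\tau}(x-y)\,e_\ell(y)\,dy\,d\beta_\ell(\tau),\qquad t\in[0,T],\ x\in\mathbb R,$$ where the integrals are Wiener integrals and the series converges in $L^2(\mathbb P)$. For $\gamma>0$ define, with values in $[0,\infty]$,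 $$\|f\|_{L^2(H^\gamma)}^2=\int_0^T\int_{\mathbb R}|f(S,k)|^2\,(|k|^{2\gamma}+1)\,dk\,dS,$$ $$\|f\|_{\mathcal K_\gamma}^2=\sup_{S\in[0,T]}S^{-2\gamma}\int_0^S\|f(\tau,\cdot)\|_{L^2}^2\,d\tau+\sup_{0\le R\le S\le T}(S-R)^{-2\gamma}\int_0^R\|f(S-R+\tau,\cdot)-f(\tau,\cdot)\|_{L^2}^2\,d\tau ,$$ where the quotients at $S=0$ and at $S=R$ are read as $0$. Let $p>1$ and $\gamma>\frac1p$. (i) (Fixed time.) There is a constant $C>0$ depending only on $p$ and $\gamma$ such that the following holds. If $\|f\|_{L^2(H^\gamma)}<\infty$, then $\Phi(T,\cdot)$ has a version with a.s. continuous paths on $\mathbb R$; and for every such version and all real $L\ge1$, $$\mathbb E\sup_{x\in[-L,L]}|\Phi(T,x)|^p\le C\,L^{\gamma p}\,\|f\|_{L^2(H^\gamma)}^p .$$ (ii) (Space-time.) There is a constant $C>0$ depending only on $p$, $\gamma$ and $T$ such that the following holds. If $\|f\|_{L^2(H^\gamma)}^2+\|f\|_{\mathcal K_\gamma}^2<\infty$,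 then $\Phi$ has a version with a.s. continuous paths on $[0,T]\times\mathbb R$; and for every such version and all real $L\ge1$, $$\mathbb E\sup_{t\in[0,T],\,x\in[-L,L]}|\Phi(t,x)|^p\le C\,L^{p\gamma}\,\bigl(\|f\|_{L^2(H^\gamma)}^2+\|f\|_{\mathcal K_\gamma}^2\bigr)^{p/2}.$$ -/

import Mathlib

open MeasureTheory ProbabilityTheory Filter Topology Set
open scoped ENNReal NNReal FourierTransform

noncomputable section

/-- A standard complex Brownian motion `β = (B₁ + i B₂) / √2` with independent standard real
Brownian motions `B₁, B₂`; thus `𝔼 β(t)² = 0` and `𝔼 |β(t)|² = t`. -/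
structure IsComplexBrownian {Ω : Type*} [MeasurableSpace Ω] (β : ℝ≥0 → Ω → ℂ) (P : Measure Ω) :
    Prop where
  re_brownian : IsBrownianReal (fun t ω => √2 * (β t ω).re) P
  im_brownian : IsBrownianReal (fun t ω => √2 * (β t ω).im) P
  indep : IndepFun (fun ω (t : ℝ≥0) => (β t ω).re) (fun ω (t : ℝ≥0) => (β t ω).im) P

/-- A complex-valued standard cylindrical Wiener process `W(t) = ∑ ℓ, β_ℓ(t) e_ℓ`: an orthonormal
basis `e` of `L²(ℝ, ℂ)` and a sequence `β` of i.i.d. standard complex Brownian motions. -/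
structure ComplexCylindricalWiener {Ω : Type*} [MeasurableSpace Ω] (P : Measure Ω) where
  e : HilbertBasis ℕ ℂ (Lp ℂ 2 (volume : Measure ℝ))
  β : ℕ → ℝ≥0 → Ω → ℂ
  brownian : ∀ l, IsComplexBrownian (β l) P
  indep : iIndepFun (fun l ω (t : ℝ≥0) => β l t ω) P

/-- Data of a deterministic step function `∑ i, c i • 1_{(a i, b i]}` on `[0, ∞)`. -/
structure StepFun where
  n : ℕ
  c : Fin n → ℂ
  a : Fin n → ℝ≥0
  b : Fin n → ℝ≥0
  le : ∀ i, a i ≤ b i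

/-- The function `∑ i, c i • 1_{(a i, b i]}`. -/
def StepFun.toFun (σ : StepFun) (s : ℝ) : ℂ :=
  ∑ i, (Ioc (σ.a i : ℝ) (σ.b i : ℝ)).indicator (fun _ => σ.c i) s

/-- The elementary stochastic integral `∑ i, c i (β(b i) - β(a i))`. -/
def StepFun.stochInt {Ω : Type*} (σ : StepFun) (β : ℝ≥0 → Ω → ℂ) (ω : Ω) : ℂ :=
  ∑ i, σ.c i * (β (σ.b i) ω - β (σ.a i) ω)

/-- `I` is (a version of) the Wiener integral `∫₀ᵗ g(τ) dβ(τ)` of the deterministic function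
`g ∈ L²(0, t)`: the `L²(P)`-limit of the elementary integrals of step functions that approximate
`g` in `L²(0, t)`. -/
def IsWienerIntegral {Ω : Type*} [MeasurableSpace Ω] (P : Measure Ω) (β : ℝ≥0 → Ω → ℂ)
    (t : ℝ) (g : ℝ → ℂ) (I : Ω → ℂ) : Prop :=
  MemLp g 2 (volume.restrict (Icc 0 t)) ∧ MemLp I 2 P ∧
    ∃ σ : ℕ → StepFun, (∀ n i, ((σ n).b i : ℝ) ≤ t) ∧
      Tendsto (fun n => eLpNorm (fun s => g s - (σ n).toFun s) 2 (volume.restrict (Icc 0 t)))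
        atTop (𝓝 0) ∧
      Tendsto (fun n => eLpNorm (fun ω => I ω - (σ n).stochInt β ω) 2 P) atTop (𝓝 0)

open Classical in
/-- The kernel `H_τ = 𝓕⁻¹ f(τ, ·)`, i.e. `H_τ(x) = (2π)⁻¹ ∫ f(τ, k) e^{ikx} dk`, as a function in
`L²(ℝ, ℂ)`. Mathlib's inverse Fourier transform uses `e^{2πiξx}`, so it is applied to
`ξ ↦ f(τ, 2πξ)`. The value is `0` for those `τ` with `f(τ, ·) ∉ L²`. -/
def greenKernel (f : ℝ → ℝ → ℂ) (τ : ℝ) : ℝ → ℂ :=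
  if h : MemLp (fun ξ : ℝ => f τ (2 * Real.pi * ξ)) 2 volume then
    ((𝓕⁻ (h.toLp _ : Lp ℂ 2 (volume : Measure ℝ)) : Lp ℂ 2 (volume : Measure ℝ)) : ℝ → ℂ)
  else 0

/-- `Y` is (a version of) the stochastic convolution at the space-time point `(t, x)`,
`∑ ℓ, ∫₀ᵗ (∫ H_{t-τ}(x - y) e_ℓ(y) dy) dβ_ℓ(τ)`, where the series converges in `L²(P)`. -/
def IsStochConvAt {Ω : Type*} [MeasurableSpace Ω] {P : Measure Ω}
    (W : ComplexCylindricalWiener P) (f : ℝ → ℝ → ℂ) (t x : ℝ) (Y : Ω → ℂ) : Prop :=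
  MemLp Y 2 P ∧ ∃ I : ℕ → Ω → ℂ,
    (∀ l, IsWienerIntegral P (W.β l) t
      (fun τ => ∫ y, greenKernel f (t - τ) (x - y) * W.e l y) (I l)) ∧
    Tendsto (fun n => eLpNorm (fun ω => Y ω - ∑ l ∈ Finset.range n, I l ω) 2 P) atTop (𝓝 0)

/-- `Ψ` is a version of the random field `Φ(T, ·)` on `ℝ` with a.s. continuous paths. -/
structure IsContStochConvFixedTime {Ω : Type*} [MeasurableSpace Ω] {P : Measure Ω}
    (W : ComplexCylindricalWiener P) (f : ℝ → ℝ → ℂ) (T : ℝ) (Ψ : ℝ → Ω → ℂ) : Prop where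
  version : ∀ x, IsStochConvAt W f T x (Ψ x)
  cont : ∀ᵐ ω ∂P, Continuous (fun x => Ψ x ω)

/-- `Φ` is a version of the stochastic convolution on `[0, T] × ℝ` with a.s. continuous paths. -/
structure IsContStochConv {Ω : Type*} [MeasurableSpace Ω] {P : Measure Ω}
    (W : ComplexCylindricalWiener P) (f : ℝ → ℝ → ℂ) (T : ℝ) (Φ : ℝ → ℝ → Ω → ℂ) : Prop where
  version : ∀ t ∈ Icc 0 T, ∀ x, IsStochConvAt W f t x (Φ t x)
  cont : ∀ᵐ ω ∂P, ContinuousOn (fun q : ℝ × ℝ => Φ q.1 q.2 ω) (Icc 0 T ×ˢ univ)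

/-- `‖f‖²_{L²(0,T;H^γ)} = ∫₀ᵀ ∫ |f(s, k)|² (|k|^{2γ} + 1) dk ds ∈ [0, ∞]`. -/
def normSqL2H (γ T : ℝ) (f : ℝ → ℝ → ℂ) : ℝ≥0∞ :=
  ∫⁻ s in Icc 0 T, ∫⁻ k : ℝ, ‖f s k‖ₑ ^ 2 * ENNReal.ofReal (|k| ^ (2 * γ) + 1)

/-- `‖f‖²_{K_γ} ∈ [0, ∞]`. The quotients at `S = 0` and at `S = R` are `∞ * 0 = 0`. -/
def normSqK (γ T : ℝ) (f : ℝ → ℝ → ℂ) : ℝ≥0∞ :=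
  (⨆ S ∈ Icc 0 T, ENNReal.ofReal S ^ (-(2 * γ)) * ∫⁻ τ in Icc 0 S, ∫⁻ k : ℝ, ‖f τ k‖ₑ ^ 2) +
  ⨆ S ∈ Icc 0 T, ⨆ R ∈ Icc 0 S, ENNReal.ofReal (S - R) ^ (-(2 * γ)) *
    ∫⁻ τ in Icc 0 R, ∫⁻ k : ℝ, ‖f (S - R + τ) k - f τ k‖ₑ ^ 2

end

noncomputable section

/-! ### Moments and covariances of complex Brownian motions -/

section ComplexBrownian

variable {Ω : Type*} [MeasurableSpace Ω] {P : Measure Ω}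

/-! The field is Gaussian, so everything reduces to second moments, and these are computed on the
frequency side. By Plancherel, the integrand of the `l`-th Wiener integral is the pairing of an
orthonormal family, `dualFreq (W.e l)`, with the field `freqField f t x`, which is `(τ, ξ) ↦
1_{[0,t]}(τ) f(t - τ, 2πξ) exp(2πiξx)`. Wiener integrals against different `β_l` are isometries with
orthogonal ranges, so Bessel's inequality bounds the `L²(P)` norm of `Φ(t,x)`, and likewise of any
increment, by the `L²` norm of the corresponding (difference of) frequency fields. Only upper bounds
are needed. Since all these variables lie in the closed span of the Brownian motions, their `q`-th
moments are controlled by their second moments for every finite `q ≥ 1`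
(`exists_eLpNorm_stochConv_le`).

It remains to estimate frequency fields. With `γ' = min γ 1`, a spatial increment costs `|exp(2πiξx)
- exp(2πiξy)| ≤ 2 (|2πξ| |x - y|)^γ'`, and the weight `|k|^{2γ} + 1` absorbs the power of the
frequency. A time increment from `s` to `t` splits at `τ = s`: on `(s, t]` only the later field
survives, on `[0, s]` the two are subtracted, and these pieces are the two suprema in `normSqK`.

Thus the increments are Hölder of order `γ'` in every `L^q(P)`. Choosing `q ≥ p` with `γ' q > 2`,
dyadic chaining in the plane gives both a continuous modification and a moment bound for the
supremum over a fixed box. Rescaling space by `L` maps `[-1, 1]` to `[-L, L]` and multiplies the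
Hölder constant by `L^γ' ≤ L^γ`, which is the growth claimed. The fixed-time field is treated as a
planar field constant in the first coordinate. -/

lemma ProbabilityTheory.IsPreBrownianReal.integral_mul_eval [IsProbabilityMeasure P]
    {B : ℝ≥0 → Ω → ℝ} (hB : IsPreBrownianReal B P) (s t : ℝ≥0) :
    ∫ ω, B s ω * B t ω ∂P = min s t := by
  have h2 (r : ℝ≥0) : MemLp (B r) 2 P := (hB.isGaussianProcess.hasGaussianLaw_eval r).memLp_two
  have h := covariance_eq_sub (h2 s) (h2 t)
  rw [hB.covariance_eval, hB.integral_eval] at h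
  simpa using h.symm

namespace IsComplexBrownian

variable {β : ℝ≥0 → Ω → ℂ}

lemma hasGaussianLaw_restrict_re (h : IsComplexBrownian β P) (I : Finset ℝ≥0) :
    HasGaussianLaw (fun ω => I.restrict (fun t => (β t ω).re)) P := by
  have hB := h.re_brownian.toIsPreBrownianReal
  have := (hB.isGaussianProcess.smul fun _ => (√2)⁻¹).hasGaussianLaw I
  refine this.congr (ae_of_all _ fun ω => ?_)
  ext t
  simp

lemma hasGaussianLaw_re (h : IsComplexBrownian β P) (t : ℝ≥0) :
    HasGaussianLaw (fun ω => (β t ω).re) P :=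
  (h.hasGaussianLaw_restrict_re {t}).eval ⟨t, by simp⟩

lemma hasGaussianLaw_restrict_im (h : IsComplexBrownian β P) (I : Finset ℝ≥0) :
    HasGaussianLaw (fun ω => I.restrict (fun t => (β t ω).im)) P := by
  have hB := h.im_brownian.toIsPreBrownianReal
  have := (hB.isGaussianProcess.smul fun _ => (√2)⁻¹).hasGaussianLaw I
  refine this.congr (ae_of_all _ fun ω => ?_)
  ext t
  simp

lemma hasGaussianLaw_im (h : IsComplexBrownian β P) (t : ℝ≥0) :
    HasGaussianLaw (fun ω => (β t ω).im) P :=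
  (h.hasGaussianLaw_restrict_im {t}).eval ⟨t, by simp⟩

/-- Gaussian means Gaussian as a real random vector. Independence of real and imaginary parts makes
the pair jointly Gaussian, and the complex vector is a real-linear image of it. -/
lemma hasGaussianLaw_restrict (h : IsComplexBrownian β P) (I : Finset ℝ≥0) :
    HasGaussianLaw (fun ω => I.restrict (β · ω)) P := by
  have hind : IndepFun (fun ω => I.restrict (fun t => (β t ω).re))
      (fun ω => I.restrict (fun t => (β t ω).im)) P :=
    h.indep.comp (φ := fun x : ℝ≥0 → ℝ => I.restrict x) (ψ := fun x : ℝ≥0 → ℝ => I.restrict x)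
      (Finset.measurable_restrict I) (Finset.measurable_restrict I)
  have hG := (h.hasGaussianLaw_restrict_re I).isGaussian_map
  have := IndepFun.hasGaussianLaw (h.hasGaussianLaw_restrict_re I)
    (h.hasGaussianLaw_restrict_im I) hind
  let A : (I → ℝ) × (I → ℝ) →L[ℝ] (I → ℂ) := ContinuousLinearMap.pi fun i =>
    Complex.ofRealCLM ∘L ContinuousLinearMap.proj i ∘L ContinuousLinearMap.fst ℝ _ _ +
    Complex.I • (Complex.ofRealCLM ∘L ContinuousLinearMap.proj i ∘L ContinuousLinearMap.snd ℝ _ _)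
  have h3 := this.map_fun A
  refine h3.congr (ae_of_all _ fun ω => funext fun i => ?_)
  simp [A, mul_comm Complex.I, Complex.re_add_im]

lemma hasGaussianLaw_eval (h : IsComplexBrownian β P) (t : ℝ≥0) : HasGaussianLaw (β t) P := by
  have := h.hasGaussianLaw_restrict {t}
  exact this.eval ⟨t, by simp⟩

lemma memLp_two (h : IsComplexBrownian β P) (t : ℝ≥0) : MemLp (β t) 2 P :=
  (h.hasGaussianLaw_eval t).memLp_two

lemma integral_re (h : IsComplexBrownian β P) (t : ℝ≥0) : ∫ ω, (β t ω).re ∂P = 0 := by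
  have := h.re_brownian.toIsPreBrownianReal.integral_eval t
  rw [integral_const_mul] at this
  simpa using this

lemma integral_im (h : IsComplexBrownian β P) (t : ℝ≥0) : ∫ ω, (β t ω).im ∂P = 0 := by
  have := h.im_brownian.toIsPreBrownianReal.integral_eval t
  rw [integral_const_mul] at this
  simpa using this

lemma integral_eval (h : IsComplexBrownian β P) (t : ℝ≥0) : ∫ ω, β t ω ∂P = 0 := by
  have hi : Integrable (β t) P := (h.hasGaussianLaw_eval t).integrable
  apply Complex.ext
  · simpa [h.integral_re t] using (_root_.integral_re (𝕜 := ℂ) hi).symm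
  · simpa [h.integral_im t] using (_root_.integral_im (𝕜 := ℂ) hi).symm

lemma integral_re_mul_re [IsProbabilityMeasure P] (h : IsComplexBrownian β P) (s t : ℝ≥0) :
    ∫ ω, (β s ω).re * (β t ω).re ∂P = min s t / 2 := by
  have := h.re_brownian.toIsPreBrownianReal.integral_mul_eval s t
  rw [← this, ← integral_div]
  congr with ω
  have : √2 * √2 = (2 : ℝ) := by simp
  linear_combination (-(β s ω).re * (β t ω).re / 2) * this

lemma integral_im_mul_im [IsProbabilityMeasure P] (h : IsComplexBrownian β P) (s t : ℝ≥0) :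
    ∫ ω, (β s ω).im * (β t ω).im ∂P = min s t / 2 := by
  have := h.im_brownian.toIsPreBrownianReal.integral_mul_eval s t
  rw [← this, ← integral_div]
  congr with ω
  have : √2 * √2 = (2 : ℝ) := by simp
  linear_combination (-(β s ω).im * (β t ω).im / 2) * this

lemma integral_re_mul_im (h : IsComplexBrownian β P) (s t : ℝ≥0) :
    ∫ ω, (β s ω).re * (β t ω).im ∂P = 0 := by
  have hind : IndepFun (fun ω => (β s ω).re) (fun ω => (β t ω).im) P :=
    h.indep.comp (φ := fun x : ℝ≥0 → ℝ => x s) (ψ := fun x : ℝ≥0 → ℝ => x t)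
      (measurable_pi_apply _) (measurable_pi_apply _)
  have := hind.integral_mul_eq_mul_integral
    (h.hasGaussianLaw_re s).aemeasurable.aestronglyMeasurable
    (h.hasGaussianLaw_im t).aemeasurable.aestronglyMeasurable
  simpa [h.integral_re] using this

/-- Real and imaginary parts each contribute `min s t / 2`; the cross terms vanish by independence
and centring. -/
lemma integral_inner_eval [IsProbabilityMeasure P] (h : IsComplexBrownian β P) (s t : ℝ≥0) :
    ∫ ω, inner ℂ (β s ω) (β t ω) ∂P = (min s t : ℝ≥0) := by
  have hm (f g : ℂ → ℝ) (hf : f = Complex.re ∨ f = Complex.im)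
      (hg : g = Complex.re ∨ g = Complex.im) (a b : ℝ≥0) :
      Integrable (fun ω => f (β a ω) * g (β b ω)) P := by
    have key (f : ℂ → ℝ) (hf : f = Complex.re ∨ f = Complex.im) (a : ℝ≥0) :
        MemLp (fun ω => f (β a ω)) 2 P := by
      rcases hf with rfl | rfl
      · exact (h.hasGaussianLaw_re a).memLp_two
      · exact (h.hasGaussianLaw_im a).memLp_two
    exact (key f hf a).integrable_mul (key g hg b)
  have hi : Integrable (fun ω => inner ℂ (β s ω) (β t ω)) P := by
    have := (h.memLp_two s).star.integrable_mul (h.memLp_two t)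
    refine this.congr (ae_of_all _ fun ω => ?_)
    simp [RCLike.inner_apply, mul_comm]
  apply Complex.ext
  · have := (_root_.integral_re (𝕜 := ℂ) hi).symm
    simp only [RCLike.re_eq_complex_re] at this
    rw [this]
    have e : (fun ω => (inner ℂ (β s ω) (β t ω)).re) = fun ω =>
        (β s ω).re * (β t ω).re + (β s ω).im * (β t ω).im := by
      ext ω; simp [RCLike.inner_apply]; ring
    rw [e, integral_add (hm _ _ (.inl rfl) (.inl rfl) _ _) (hm _ _ (.inr rfl) (.inr rfl) _ _),
      h.integral_re_mul_re, h.integral_im_mul_im]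
    simp
  · have := (_root_.integral_im (𝕜 := ℂ) hi).symm
    simp only [RCLike.im_eq_complex_im] at this
    rw [this]
    have e : (fun ω => (inner ℂ (β s ω) (β t ω)).im) = fun ω =>
        (β s ω).re * (β t ω).im - (β t ω).re * (β s ω).im := by
      ext ω; simp [RCLike.inner_apply]; ring
    rw [e, integral_sub (hm _ _ (.inl rfl) (.inr rfl) _ _) (hm _ _ (.inl rfl) (.inr rfl) _ _),
      h.integral_re_mul_im, h.integral_re_mul_im]
    simp

end IsComplexBrownian

/-- Equivalence of moments for centred real Gaussian random variables. -/
lemma exists_eLpNorm_le_of_hasGaussianLaw (q : ℝ≥0∞) (hq : q ≠ ∞) :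
    ∃ C : ℝ≥0, ∀ {Ω : Type*} [MeasurableSpace Ω] (P : Measure Ω) (X : Ω → ℝ),
      HasGaussianLaw X P → ∫ ω, X ω ∂P = 0 → eLpNorm X q P ≤ C * eLpNorm X 2 P := by
  refine ⟨(eLpNorm id q (gaussianReal 0 1)).toNNReal, fun {Ω} _ P X hX h0 => ?_⟩
  have := hX.isProbabilityMeasure
  have hfin : eLpNorm id q (gaussianReal 0 1) ≠ ∞ := (memLp_id_gaussianReal' q hq).2.ne
  rw [ENNReal.coe_toNNReal hfin]
  set v := Var[X; P] with hv
  have hv0 : 0 ≤ v := variance_nonneg _ _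
  -- `X` is distributed as `√v` times a standard Gaussian, so every `L^r` norm is `√v` times a
  -- universal constant, which equals `1` for `r = 2`.
  have hmap : P.map X = (gaussianReal 0 1).map (fun x => √v * x) := by
    rw [hX.map_eq_gaussianReal, gaussianReal_map_const_mul, h0, mul_zero, mul_one]
    congr 1
    ext
    simp [Real.sq_sqrt hv0, ← hv, hv0]
  have hnorm (r : ℝ≥0∞) : eLpNorm X r P = ENNReal.ofReal √v * eLpNorm id r (gaussianReal 0 1) := by
    have h1 : eLpNorm X r P = eLpNorm id r (P.map X) := by
      rw [eLpNorm_map_measure aestronglyMeasurable_id hX.aemeasurable]; rfl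
    rw [h1, hmap, eLpNorm_map_measure aestronglyMeasurable_id (by fun_prop)]
    have : id ∘ (fun x => √v * x) = √v • (id : ℝ → ℝ) := rfl
    rw [this, eLpNorm_const_smul, Real.enorm_of_nonneg (Real.sqrt_nonneg _)]
  have h2 : eLpNorm (id : ℝ → ℝ) 2 (gaussianReal 0 1) = 1 := by
    have hm := (memLp_id_gaussianReal' (μ := 0) (v := 1) 2 (by norm_num))
    have hvar := variance_id_gaussianReal (μ := 0) (v := 1)
    rw [variance_eq_integral aemeasurable_id] at hvar
    rw [hm.eLpNorm_eq_integral_rpow_norm (by norm_num) (by norm_num)]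
    simp only [id_eq, integral_id_gaussianReal, sub_zero] at hvar
    simp [hvar]
  rw [hnorm q, hnorm 2, h2, mul_one, mul_comm]

/-- The real and imaginary parts are centred real Gaussians dominated by `X` in norm; Minkowski's
inequality adds them, whence `1 ≤ q` and the factor 2. -/
lemma exists_eLpNorm_le_of_hasGaussianLaw_complex (q : ℝ≥0∞) (hq : q ≠ ∞) (hq1 : 1 ≤ q) :
    ∃ C : ℝ≥0, ∀ {Ω : Type*} [MeasurableSpace Ω] (P : Measure Ω) (X : Ω → ℂ),
      HasGaussianLaw X P → ∫ ω, X ω ∂P = 0 → eLpNorm X q P ≤ C * eLpNorm X 2 P := by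
  obtain ⟨C, hC⟩ := exists_eLpNorm_le_of_hasGaussianLaw q hq
  refine ⟨2 * C, fun {Ω} _ P X hX h0 => ?_⟩
  have hi := hX.integrable
  have hre : HasGaussianLaw (fun ω => (X ω).re) P := hX.map_fun Complex.reCLM
  have him : HasGaussianLaw (fun ω => (X ω).im) P := hX.map_fun Complex.imCLM
  have hre0 : ∫ ω, (X ω).re ∂P = 0 := by
    have := (_root_.integral_re (𝕜 := ℂ) hi)
    simpa [h0] using this
  have him0 : ∫ ω, (X ω).im ∂P = 0 := by
    have := (_root_.integral_im (𝕜 := ℂ) hi)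
    simpa [h0] using this
  have e : X = (fun ω => ((X ω).re : ℂ)) + Complex.I • (fun ω => ((X ω).im : ℂ)) := by
    ext ω
    simp [mul_comm Complex.I, Complex.re_add_im]
  have hn (g : Ω → ℝ) (r : ℝ≥0∞) : eLpNorm (fun ω => (g ω : ℂ)) r P = eLpNorm g r P :=
    eLpNorm_congr_norm_ae (ae_of_all _ fun ω => by simp)
  calc eLpNorm X q P ≤ eLpNorm (fun ω => ((X ω).re : ℂ)) q P +
        eLpNorm (Complex.I • (fun ω => ((X ω).im : ℂ))) q P := by
        conv_lhs => rw [e]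
        refine eLpNorm_add_le ?_ ?_ hq1
        · exact (Complex.continuous_ofReal.measurable.comp_aemeasurable
            hre.aemeasurable).aestronglyMeasurable
        · exact ((Complex.continuous_ofReal.measurable.comp_aemeasurable
            him.aemeasurable).const_smul _).aestronglyMeasurable
    _ = eLpNorm (fun ω => (X ω).re) q P + eLpNorm (fun ω => (X ω).im) q P := by
        rw [eLpNorm_const_smul, hn, hn, ← ofReal_norm, Complex.norm_I, ENNReal.ofReal_one, one_mul]
    _ ≤ C * eLpNorm X 2 P + C * eLpNorm X 2 P := by
        gcongr
        · refine (hC P _ hre hre0).trans ?_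
          gcongr
          exact eLpNorm_mono fun ω => by simpa using Complex.abs_re_le_norm (X ω)
        · refine (hC P _ him him0).trans ?_
          gcongr
          exact eLpNorm_mono fun ω => by simpa using Complex.abs_im_le_norm (X ω)
    _ = (2 * C : ℝ≥0) * eLpNorm X 2 P := by push_cast; ring

end ComplexBrownian

/-! ### Joint Gaussianity and covariances of the family of Brownian motions -/

namespace ComplexCylindricalWiener

variable {Ω : Type*} [MeasurableSpace Ω] {P : Measure Ω} (W : ComplexCylindricalWiener P)

/-- The support of `c` sits in a finite rectangle of indices and times. Over it the vectors are
Gaussian for each index and independent across indices, hence jointly Gaussian. -/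
lemma hasGaussianLaw_sum (c : ℕ × ℝ≥0 →₀ ℂ) :
    HasGaussianLaw (fun ω => c.sum fun i a => a * W.β i.1 i.2 ω) P := by
  classical
  let S := c.support.image Prod.fst
  let I := c.support.image Prod.snd
  have hind : iIndepFun (fun (l : S) ω => I.restrict (W.β l · ω)) P := by
    have := (W.indep.comp (fun _ x => I.restrict x) (fun _ => Finset.measurable_restrict I))
    exact this.precomp (g := ((↑) : S → ℕ)) Subtype.val_injective
  have hG := hind.hasGaussianLaw (fun l : S => (W.brownian l).hasGaussianLaw_restrict I)
  let A : (S → I → ℂ) →L[ℝ] ℂ := ∑ i ∈ c.support.attach,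
    c i • (ContinuousLinearMap.proj (R := ℝ) (φ := fun _ : I => ℂ)
      ⟨i.1.2, Finset.mem_image_of_mem _ i.2⟩ ∘L
      ContinuousLinearMap.proj (R := ℝ) (φ := fun _ : S => I → ℂ)
        ⟨i.1.1, Finset.mem_image_of_mem _ i.2⟩)
  have h3 := hG.map_fun A
  refine h3.congr (ae_of_all _ fun ω => ?_)
  simp only [Finsupp.sum]
  rw [← Finset.sum_attach]
  simp [A]

lemma integral_sum (c : ℕ × ℝ≥0 →₀ ℂ) :
    ∫ ω, (c.sum fun i a => a * W.β i.1 i.2 ω) ∂P = 0 := by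
  simp only [Finsupp.sum]
  rw [integral_finsetSum]
  · refine Finset.sum_eq_zero fun i _ => ?_
    rw [integral_const_mul, (W.brownian i.1).integral_eval, mul_zero]
  · intro i _
    exact ((W.brownian i.1).hasGaussianLaw_eval i.2).integrable.const_mul _

lemma integral_inner [IsProbabilityMeasure P] (i j : ℕ × ℝ≥0) :
    ∫ ω, inner ℂ (W.β i.1 i.2 ω) (W.β j.1 j.2 ω) ∂P =
      if i.1 = j.1 then ((min i.2 j.2 : ℝ≥0) : ℂ) else 0 := by
  obtain ⟨l, s⟩ := i
  obtain ⟨m, t⟩ := j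
  split_ifs with h
  · obtain rfl : l = m := h
    exact (W.brownian l).integral_inner_eval s t
  · have hind : IndepFun (fun ω => (starRingEnd ℂ) (W.β l s ω)) (W.β m t) P :=
      (W.indep.indepFun h).comp (φ := fun x : ℝ≥0 → ℂ => (starRingEnd ℂ) (x s))
        (ψ := fun x : ℝ≥0 → ℂ => x t) (by fun_prop) (measurable_pi_apply _)
    have := hind.integral_mul_eq_mul_integral
      ((W.brownian l).memLp_two s).star.1 ((W.brownian m).memLp_two t).1
    rw [(W.brownian m).integral_eval, mul_zero] at this
    rw [← this]
    congr with ω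
    simp [RCLike.inner_apply, mul_comm]

end ComplexCylindricalWiener

/-! ### The Wiener integral as an isometry -/

/-- Two families with the same Gram matrix are related by a linear isometry. -/
lemma exists_linearIsometry_of_inner_eq {ι K H : Type*} [NormedAddCommGroup K]
    [InnerProductSpace ℂ K] [NormedAddCommGroup H] [InnerProductSpace ℂ H] [CompleteSpace H]
    (v : ι → K) (w : ι → H) (hd : Dense (Submodule.span ℂ (range v) : Set K))
    (h : ∀ i j, inner ℂ (v i) (v j) = inner ℂ (w i) (w j)) :
    ∃ T : K →ₗᵢ[ℂ] H, ∀ i, T (v i) = w i := by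
  let e := Finsupp.linearCombination ℂ v
  let f := Finsupp.linearCombination ℂ w
  have hinner (c : ι →₀ ℂ) : inner ℂ (e c) (e c) = inner ℂ (f c) (f c) := by
    simp only [e, f, Finsupp.linearCombination_apply, Finsupp.sum, sum_inner, inner_sum,
      inner_smul_left, inner_smul_right, h]
  have hnorm (c : ι →₀ ℂ) : ‖f c‖ = ‖e c‖ := by
    rw [@norm_eq_sqrt_re_inner ℂ, @norm_eq_sqrt_re_inner ℂ K, hinner]
  have hde : DenseRange e := by
    have : range e = (Submodule.span ℂ (range v) : Set K) := by
      rw [← Finsupp.range_linearCombination]; rfl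
    rw [DenseRange, this]
    exact hd
  -- Equality of norms also forces `f` to vanish on the kernel of `e`, so the assignment is well
  -- defined even if the vectors `v i` are linearly dependent.
  have hT := LinearMap.extendOfNorm_eq (f := f) hde ⟨1, fun x => by rw [one_mul, hnorm]⟩
  refine ⟨⟨(f.extendOfNorm e).toLinearMap, fun x => ?_⟩, fun i => ?_⟩
  · refine hde.induction_on (p := fun x => ‖f.extendOfNorm e x‖ = ‖x‖) x
      (isClosed_eq (by fun_prop) (by fun_prop)) fun c => ?_
    rw [hT, hnorm]
  · have := hT (Finsupp.single i 1)
    simpa [e, f] using this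

/-- Lebesgue measure on `[0, ∞)`. -/
def halfLine : Measure ℝ := volume.restrict (Ici 0)

instance : SigmaFinite halfLine := by unfold halfLine; infer_instance

lemma halfLine_Ioc_ne_top (t : ℝ≥0) : halfLine (Ioc 0 (t : ℝ)) ≠ ∞ :=
  ((Measure.restrict_apply_le _ _).trans_lt measure_Ioc_lt_top).ne

/-- The indicator of `(0, t]` as an element of `L²([0, ∞))`. -/
def indicatorTo (t : ℝ≥0) : Lp ℂ 2 halfLine :=
  indicatorConstLp 2 (measurableSet_Ioc (a := (0 : ℝ)) (b := t)) (halfLine_Ioc_ne_top t) 1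

lemma halfLine_restrict {s : Set ℝ} (hs : s ⊆ Ici 0) (hm : MeasurableSet s) :
    halfLine.restrict s = volume.restrict s := by
  rw [halfLine, Measure.restrict_restrict hm, inter_eq_self_of_subset_left hs]

/-- This is the Gram matrix of a single Brownian motion in `L²(P)`, which is why `indicatorTo t ↦
β_l(t)` extends to an isometry. -/
lemma inner_indicatorTo (s t : ℝ≥0) :
    inner ℂ (indicatorTo s) (indicatorTo t) = ((min s t : ℝ≥0) : ℂ) := by
  rw [indicatorTo, L2.inner_indicatorConstLp_one]
  have h : ∫ x in Ioc 0 (s : ℝ), (indicatorTo t : ℝ → ℂ) x ∂halfLine =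
      ∫ x in Ioc 0 (s : ℝ), (Ioc 0 (t : ℝ)).indicator (fun _ => (1 : ℂ)) x ∂halfLine :=
    setIntegral_congr_ae measurableSet_Ioc
      (indicatorConstLp_coeFn.mono fun x hx _ => hx)
  rw [h, halfLine_restrict (fun x hx => hx.1.le) measurableSet_Ioc,
    setIntegral_indicator measurableSet_Ioc]
  simp [Ioc_inter_Ioc]

/-- A function orthogonal to all these indicators has zero primitive on `[0, ∞)`, hence vanishes
almost everywhere by Lebesgue differentiation. -/
lemma dense_span_indicatorTo :
    Dense (Submodule.span ℂ (range indicatorTo) : Set (Lp ℂ 2 halfLine)) := by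
  rw [Submodule.dense_iff_topologicalClosure_eq_top, Submodule.topologicalClosure_eq_top_iff,
    Submodule.eq_bot_iff]
  intro g hg
  have h0 (t : ℝ≥0) : ∫ x in Ioc 0 (t : ℝ), g x ∂halfLine = 0 := by
    have := (Submodule.mem_orthogonal _ _).1 hg _ (Submodule.subset_span ⟨t, rfl⟩)
    rwa [indicatorTo, L2.inner_indicatorConstLp_one] at this
  have hG : MemLp ((Ici 0).indicator g) 2 (volume : Measure ℝ) :=
    (memLp_indicator_iff_restrict measurableSet_Ici).2 (Lp.memLp g)
  have hd := LocallyIntegrable.ae_hasDerivAt_integral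
    (hG.locallyIntegrable (by norm_num : (1 : ℝ≥0∞) ≤ 2))
  have hint (x : ℝ) (hx : 0 ≤ x) : ∫ y in (0 : ℝ)..x, (Ici 0).indicator g y = 0 := by
    rw [intervalIntegral.integral_of_le hx, ← h0 ⟨x, hx⟩,
      halfLine_restrict (fun x hx => hx.1.le) measurableSet_Ioc]
    exact setIntegral_congr_fun measurableSet_Ioc fun y hy => indicator_of_mem hy.1.le _
  rw [Lp.eq_zero_iff_ae_eq_zero]
  have h1 : ∀ᵐ x ∂halfLine, x ≠ 0 := ae_restrict_of_ae (by simp [ae_iff])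
  filter_upwards [ae_restrict_of_ae hd, h1, ae_restrict_mem measurableSet_Ici] with x hx hx0 hx1
  have hpos : 0 < x := lt_of_le_of_ne hx1 hx0.symm
  have h2 : HasDerivAt (fun x => ∫ y in (0 : ℝ)..x, (Ici 0).indicator g y) 0 x := by
    refine (hasDerivAt_const x (0 : ℂ)).congr_of_eventuallyEq ?_
    filter_upwards [lt_mem_nhds hpos] with y hy using hint y hy.le
  have := (hx 0).unique h2
  rwa [indicator_of_mem (show x ∈ Ici 0 from hx1)] at this

namespace ComplexCylindricalWiener

variable {Ω : Type*} [MeasurableSpace Ω] {P : Measure Ω} (W : ComplexCylindricalWiener P)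

/-- The Brownian motion `β_l(t)` as an element of `L²(P)`. -/
def βLp (i : ℕ × ℝ≥0) : Lp ℂ 2 P := ((W.brownian i.1).memLp_two i.2).toLp

lemma coeFn_βLp (i : ℕ × ℝ≥0) : W.βLp i =ᵐ[P] W.β i.1 i.2 := MemLp.coeFn_toLp _

variable [IsProbabilityMeasure P]

lemma inner_βLp (i j : ℕ × ℝ≥0) :
    inner ℂ (W.βLp i) (W.βLp j) = if i.1 = j.1 then ((min i.2 j.2 : ℝ≥0) : ℂ) else 0 := by
  rw [← W.integral_inner, L2.inner_def]
  refine integral_congr_ae ?_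
  filter_upwards [W.coeFn_βLp i, W.coeFn_βLp j] with ω h1 h2
  rw [h1, h2]

lemma exists_wienerIsometry (l : ℕ) :
    ∃ T : Lp ℂ 2 halfLine →ₗᵢ[ℂ] Lp ℂ 2 P, ∀ t, T (indicatorTo t) = W.βLp (l, t) :=
  exists_linearIsometry_of_inner_eq _ _ dense_span_indicatorTo fun s t => by
    rw [inner_indicatorTo, inner_βLp]; simp

/-- The Wiener integral with respect to `β_l`, as an isometry `L²([0, ∞)) → L²(P)`. -/
def wienerIsometry (l : ℕ) : Lp ℂ 2 halfLine →ₗᵢ[ℂ] Lp ℂ 2 P :=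
  (W.exists_wienerIsometry l).choose

lemma wienerIsometry_indicatorTo (l : ℕ) (t : ℝ≥0) :
    W.wienerIsometry l (indicatorTo t) = W.βLp (l, t) :=
  (W.exists_wienerIsometry l).choose_spec t

/-- Distinct Brownian motions are orthogonal, so the claim holds on indicators; density extends it
first in one argument, then in the other. -/
lemma orthogonalFamily_wienerIsometry :
    OrthogonalFamily ℂ (fun _ : ℕ => Lp ℂ 2 halfLine) W.wienerIsometry := by
  intro l m hlm u v
  have h1 (s : ℝ≥0) (v : Lp ℂ 2 halfLine) :
      inner ℂ (W.wienerIsometry l (indicatorTo s)) (W.wienerIsometry m v) = 0 := by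
    have : (innerSL ℂ (W.wienerIsometry l (indicatorTo s))).comp
        (W.wienerIsometry m).toContinuousLinearMap = 0 := by
      refine ContinuousLinearMap.ext_on dense_span_indicatorTo ?_
      rintro _ ⟨t, rfl⟩
      simp [wienerIsometry_indicatorTo, inner_βLp, hlm]
    simpa using DFunLike.congr_fun this v
  have : (innerSL ℂ (W.wienerIsometry m v)).comp
      (W.wienerIsometry l).toContinuousLinearMap = 0 := by
    refine ContinuousLinearMap.ext_on dense_span_indicatorTo ?_
    rintro _ ⟨t, rfl⟩
    simpa using inner_eq_zero_symm.1 (h1 t v)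
  exact inner_eq_zero_symm.1 (by simpa using DFunLike.congr_fun this u)

/-- The closed linear span of the Brownian motions in `L²(P)`. -/
def gaussianSpace : Submodule ℂ (Lp ℂ 2 P) := (Submodule.span ℂ (range W.βLp)).topologicalClosure

lemma wienerIsometry_mem_gaussianSpace (l : ℕ) (u : Lp ℂ 2 halfLine) :
    W.wienerIsometry l u ∈ W.gaussianSpace := by
  have hcl : IsClosed ((W.gaussianSpace.comap (W.wienerIsometry l).toLinearMap : Submodule ℂ _) :
      Set (Lp ℂ 2 halfLine)) :=
    (Submodule.isClosed_topologicalClosure _).preimage (W.wienerIsometry l).continuous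
  have hle : Submodule.span ℂ (range indicatorTo) ≤
      W.gaussianSpace.comap (W.wienerIsometry l).toLinearMap := by
    rw [Submodule.span_le]
    rintro _ ⟨t, rfl⟩
    refine Submodule.le_topologicalClosure _ (Submodule.subset_span ⟨(l, t), ?_⟩)
    exact (W.wienerIsometry_indicatorTo l t).symm
  have := Submodule.topologicalClosure_minimal _ hle hcl
  rw [Submodule.dense_iff_topologicalClosure_eq_top.1 dense_span_indicatorTo] at this
  exact this trivial

end ComplexCylindricalWiener

/-- Equivalence of moments on the closed linear span of the Brownian motions. -/
lemma exists_eLpNorm_le_of_mem_gaussianSpace (q : ℝ≥0∞) (hq : q ≠ ∞) (hq1 : 1 ≤ q) :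
    ∃ C : ℝ≥0, ∀ {Ω : Type*} [MeasurableSpace Ω] (P : Measure Ω) [IsProbabilityMeasure P]
      (W : ComplexCylindricalWiener P) (X : Lp ℂ 2 P), X ∈ W.gaussianSpace →
        eLpNorm X q P ≤ C * eLpNorm X 2 P := by
  obtain ⟨C, hC⟩ := exists_eLpNorm_le_of_hasGaussianLaw_complex q hq hq1
  refine ⟨C, fun {Ω} _ P _ W X hX => ?_⟩
  obtain ⟨x, hx, hlim⟩ := mem_closure_iff_seq_limit.1 hX
  have hb (n : ℕ) : eLpNorm (x n) q P ≤ C * eLpNorm (x n) 2 P := by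
    obtain ⟨c, hc⟩ := (Finsupp.mem_span_range_iff_exists_finsupp).1 (hx n)
    have hae : x n =ᵐ[P] fun ω => c.sum fun i a => a * W.β i.1 i.2 ω := by
      rw [← hc]
      simp only [Finsupp.sum]
      have h1 : ∀ᵐ ω ∂P, ∀ i, W.βLp i ω = W.β i.1 i.2 ω ∨ i ∉ c.support := by
        have : ∀ᵐ ω ∂P, ∀ i ∈ c.support, W.βLp i ω = W.β i.1 i.2 ω := by
          rw [Filter.eventually_all_finset]
          exact fun i _ => W.coeFn_βLp i
        filter_upwards [this] with ω hω i
        by_cases hi : i ∈ c.support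
        · exact .inl (hω i hi)
        · exact .inr hi
      have h2 : ∀ᵐ ω ∂P, ∀ i ∈ c.support, (c i • W.βLp i : Lp ℂ 2 P) ω = c i * W.βLp i ω := by
        rw [Filter.eventually_all_finset]
        intro i _
        filter_upwards [Lp.coeFn_smul (c i) (W.βLp i)] with ω hω
        rw [hω]; rfl
      filter_upwards [Lp.coeFn_finsetSum c.support (fun i => c i • W.βLp i), h1, h2]
        with ω hs h1 h2
      rw [hs]
      simp only [Finset.sum_apply]
      refine Finset.sum_congr rfl fun i hi => ?_
      rw [h2 i hi, (h1 i).resolve_right (not_not.2 hi)]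
    rw [eLpNorm_congr_ae hae, eLpNorm_congr_ae hae]
    exact hC P _ (W.hasGaussianLaw_sum c) (W.integral_sum c)
  -- Convergence in `L²` gives almost sure convergence along a subsequence, and Fatou's lemma
  -- carries the `L^q` bound to the limit. Whether the limit itself is Gaussian need not be decided.
  have hm := tendstoInMeasure_of_tendsto_eLpNorm (p := 2) (by norm_num)
    (fun n => Lp.aestronglyMeasurable (x n)) (Lp.aestronglyMeasurable X)
    ((Lp.tendsto_Lp_iff_tendsto_eLpNorm' _ _).1 hlim)
  obtain ⟨ns, hns, hae⟩ := hm.exists_seq_tendsto_ae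
  refine (Lp.eLpNorm_lim_le_liminf_eLpNorm (fun n => Lp.aestronglyMeasurable (x (ns n))) X
    hae).trans ?_
  have hn2 : Tendsto (fun n => C * eLpNorm (x (ns n)) 2 P) atTop (𝓝 (C * eLpNorm X 2 P)) := by
    refine ENNReal.Tendsto.const_mul ?_ (.inr ENNReal.coe_ne_top)
    have := (continuous_enorm.tendsto X).comp (hlim.comp hns.tendsto_atTop)
    simpa only [Function.comp_def, Lp.enorm_def] using this
  rw [← hn2.liminf_eq]
  exact liminf_le_liminf (Eventually.of_forall fun n => hb _)

/-! ### Step functions and their elementary integrals under the isometry -/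

namespace StepFun

/-- The class in `L²([0, ∞))` of a step function. -/
def toLpHalfLine (σ : StepFun) : Lp ℂ 2 halfLine :=
  ∑ i, σ.c i • (indicatorTo (σ.b i) - indicatorTo (σ.a i))

lemma coeFn_toLpHalfLine (σ : StepFun) : σ.toLpHalfLine =ᵐ[halfLine] σ.toFun := by
  have h1 : ∀ᵐ x ∂halfLine, ∀ i, (σ.c i • (indicatorTo (σ.b i) - indicatorTo (σ.a i)) :
      Lp ℂ 2 halfLine) x = (Ioc (σ.a i : ℝ) (σ.b i : ℝ)).indicator (fun _ => σ.c i) x := by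
    rw [ae_all_iff]
    intro i
    have hi (t : ℝ≥0) : indicatorTo t =ᵐ[halfLine] (Ioc 0 (t : ℝ)).indicator (fun _ => (1 : ℂ)) :=
      indicatorConstLp_coeFn
    filter_upwards [Lp.coeFn_smul (σ.c i) (indicatorTo (σ.b i) - indicatorTo (σ.a i)),
      Lp.coeFn_sub (indicatorTo (σ.b i)) (indicatorTo (σ.a i)), hi (σ.a i), hi (σ.b i)]
      with x h1 h2 h3 h4
    rw [h1, Pi.smul_apply, h2, Pi.sub_apply, h3, h4]
    have hab : (σ.a i : ℝ) ≤ σ.b i := σ.le i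
    have ha : (0 : ℝ) ≤ σ.a i := (σ.a i).2
    simp only [indicator, mem_Ioc, smul_eq_mul]
    split_ifs <;> grind
  filter_upwards [Lp.coeFn_finsetSum Finset.univ
    (fun i => (σ.c i • (indicatorTo (σ.b i) - indicatorTo (σ.a i)) : Lp ℂ 2 halfLine)), h1]
    with x h2 h1
  rw [toLpHalfLine, h2, Finset.sum_apply, toFun]
  exact Finset.sum_congr rfl fun i _ => h1 i

lemma coeFn_wienerIsometry {Ω : Type*} [MeasurableSpace Ω] {P : Measure Ω}
    [IsProbabilityMeasure P] (W : ComplexCylindricalWiener P) (l : ℕ) (σ : StepFun) :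
    W.wienerIsometry l σ.toLpHalfLine =ᵐ[P] σ.stochInt (W.β l) := by
  have h0 : W.wienerIsometry l σ.toLpHalfLine =
      ∑ i, σ.c i • (W.βLp (l, σ.b i) - W.βLp (l, σ.a i)) := by
    simp [toLpHalfLine, ComplexCylindricalWiener.wienerIsometry_indicatorTo]
  rw [h0]
  have h1 : ∀ᵐ x ∂P, ∀ i, (σ.c i • (W.βLp (l, σ.b i) - W.βLp (l, σ.a i)) : Lp ℂ 2 P) x =
      σ.c i * (W.β l (σ.b i) x - W.β l (σ.a i) x) := by
    rw [ae_all_iff]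
    intro i
    filter_upwards [Lp.coeFn_smul (σ.c i) (W.βLp (l, σ.b i) - W.βLp (l, σ.a i)),
      Lp.coeFn_sub (W.βLp (l, σ.b i)) (W.βLp (l, σ.a i)), W.coeFn_βLp (l, σ.a i),
      W.coeFn_βLp (l, σ.b i)] with x h1 h2 h3 h4
    rw [h1, Pi.smul_apply, h2, Pi.sub_apply, h3, h4]
    rfl
  filter_upwards [Lp.coeFn_finsetSum Finset.univ
    (fun i => (σ.c i • (W.βLp (l, σ.b i) - W.βLp (l, σ.a i)) : Lp ℂ 2 P)), h1] with x h2 h1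
  rw [h2, Finset.sum_apply, stochInt]
  exact Finset.sum_congr rfl fun i _ => h1 i

lemma toFun_eq_zero {σ : StepFun} {t s : ℝ} (hσ : ∀ i, (σ.b i : ℝ) ≤ t) (hs : s ∉ Icc 0 t) :
    σ.toFun s = 0 := by
  refine Finset.sum_eq_zero fun i _ => indicator_of_notMem (fun hi => hs ?_) _
  exact ⟨(σ.a i).2.trans hi.1.le, hi.2.trans (hσ i)⟩

/-- The step function `∑ r, c r • 1_{(0, min r t]}`. -/
def ofFinsupp (c : ℝ≥0 →₀ ℂ) (t : ℝ≥0) : StepFun where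
  n := c.support.card
  c i := c (c.support.equivFin.symm i)
  a _ := 0
  b i := min (c.support.equivFin.symm i) t
  le _ := zero_le

lemma ofFinsupp_toFun (c : ℝ≥0 →₀ ℂ) (t : ℝ≥0) (s : ℝ) (hs : s ≤ t) :
    (ofFinsupp c t).toFun s = ∑ r ∈ c.support, c r * (Ioc 0 (r : ℝ)).indicator (fun _ => 1) s := by
  rw [← Finset.sum_coe_sort, ← c.support.equivFin.symm.sum_comp]
  refine Finset.sum_congr rfl fun i _ => ?_
  simp [ofFinsupp, indicator, hs]

end StepFun

lemma eLpNorm_halfLine_indicator (t : ℝ) (g : ℝ → ℂ) :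
    eLpNorm ((Icc 0 t).indicator g) 2 halfLine = eLpNorm g 2 (volume.restrict (Icc 0 t)) := by
  rw [eLpNorm_indicator_eq_eLpNorm_restrict measurableSet_Icc,
    halfLine_restrict Icc_subset_Ici_self measurableSet_Icc]

lemma memLp_halfLine_indicator {t : ℝ} {g : ℝ → ℂ} :
    MemLp ((Icc 0 t).indicator g) 2 halfLine ↔ MemLp g 2 (volume.restrict (Icc 0 t)) := by
  rw [memLp_indicator_iff_restrict measurableSet_Icc,
    halfLine_restrict Icc_subset_Ici_self measurableSet_Icc]

/-- Step functions on `(0, t]` are dense in `L²(0, t)`. -/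
lemma exists_stepFun_tendsto (t : ℝ≥0) {g : ℝ → ℂ} (hg : MemLp g 2 (volume.restrict (Icc 0 (t : ℝ)))) :
    ∃ σ : ℕ → StepFun, (∀ n i, ((σ n).b i : ℝ) ≤ t) ∧
      Tendsto (fun n => eLpNorm (fun s => g s - (σ n).toFun s) 2
        (volume.restrict (Icc 0 (t : ℝ)))) atTop (𝓝 0) := by
  set G := (memLp_halfLine_indicator.2 hg).toLp with hG
  have hGc : G =ᵐ[halfLine] (Icc 0 (t : ℝ)).indicator g := MemLp.coeFn_toLp _
  obtain ⟨x, hx, hlim⟩ := mem_closure_iff_seq_limit.1 (dense_span_indicatorTo G)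
  choose c hc using fun n => (Finsupp.mem_span_range_iff_exists_finsupp).1 (hx n)
  -- The approximants from the dense span may reach beyond `t`; truncating the endpoints at `t`
  -- leaves their values on `[0, t]` unchanged.
  refine ⟨fun n => StepFun.ofFinsupp (c n) t, fun n i => ?_, ?_⟩
  · exact NNReal.coe_le_coe.2 (min_le_right _ _)
  refine tendsto_of_tendsto_of_tendsto_of_le_of_le tendsto_const_nhds
    ((Lp.tendsto_Lp_iff_tendsto_eLpNorm' _ _).1 hlim) (fun _ => zero_le) fun n => ?_
  have hxn : x n =ᵐ[halfLine]
      fun s => ∑ r ∈ (c n).support, c n r * (Ioc 0 (r : ℝ)).indicator (fun _ => 1) s := by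
    rw [← hc n]
    have h1 : ∀ᵐ s ∂halfLine, ∀ r ∈ (c n).support,
        (c n r • indicatorTo r : Lp ℂ 2 halfLine) s =
          c n r * (Ioc 0 (r : ℝ)).indicator (fun _ => 1) s := by
      rw [Filter.eventually_all_finset]
      intro r _
      have hi : indicatorTo r =ᵐ[halfLine] (Ioc 0 (r : ℝ)).indicator (fun _ => (1 : ℂ)) :=
        indicatorConstLp_coeFn
      filter_upwards [Lp.coeFn_smul (c n r) (indicatorTo r), hi] with s h1 h2
      rw [h1, Pi.smul_apply, h2, smul_eq_mul]
    filter_upwards [Lp.coeFn_finsetSum (c n).support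
      (fun r => (c n r • indicatorTo r : Lp ℂ 2 halfLine)), h1] with s h2 h1
    rw [Finsupp.sum, h2, Finset.sum_apply]
    exact Finset.sum_congr rfl h1
  calc eLpNorm (fun s => g s - (StepFun.ofFinsupp (c n) t).toFun s) 2
        (volume.restrict (Icc 0 (t : ℝ)))
      = eLpNorm (x n - G : ℝ → ℂ) 2 (volume.restrict (Icc 0 (t : ℝ))) := by
        rw [← neg_sub, eLpNorm_neg]
        refine eLpNorm_congr_ae ?_
        have hac : volume.restrict (Icc 0 (t : ℝ)) ≤ halfLine :=
          Measure.restrict_mono Icc_subset_Ici_self le_rfl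
        filter_upwards [ae_mono hac hxn, ae_mono hac hGc, ae_restrict_mem measurableSet_Icc]
          with s h1 h2 h3
        rw [Pi.sub_apply, h1, h2, indicator_of_mem h3, StepFun.ofFinsupp_toFun _ _ _ h3.2]
    _ ≤ eLpNorm (x n - G : ℝ → ℂ) 2 halfLine :=
        eLpNorm_mono_measure _ (Measure.restrict_mono Icc_subset_Ici_self le_rfl)

/-! ### Wiener integrals: uniqueness and existence through the isometry -/

section IsWienerIntegral

variable {Ω : Type*} [MeasurableSpace Ω] {P : Measure Ω} [IsProbabilityMeasure P]
  (W : ComplexCylindricalWiener P)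

/-- Since the steps end by time `t`, both functions vanish beyond `t`, and convergence on `[0, t]`
is convergence on the half-line. -/
lemma tendsto_toLpHalfLine {t : ℝ} {g : ℝ → ℂ} (hg : MemLp g 2 (volume.restrict (Icc 0 t)))
    {σ : ℕ → StepFun} (hσ : ∀ n i, ((σ n).b i : ℝ) ≤ t)
    (hlim : Tendsto (fun n => eLpNorm (fun s => g s - (σ n).toFun s) 2
        (volume.restrict (Icc 0 t))) atTop (𝓝 0)) :
    Tendsto (fun n => (σ n).toLpHalfLine) atTop (𝓝 (memLp_halfLine_indicator.2 hg).toLp) := by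
  rw [Lp.tendsto_Lp_iff_tendsto_eLpNorm']
  refine hlim.congr fun n => ?_
  rw [← eLpNorm_halfLine_indicator, ← eLpNorm_neg]
  refine eLpNorm_congr_ae ?_
  filter_upwards [(σ n).coeFn_toLpHalfLine, (memLp_halfLine_indicator.2 hg).coeFn_toLp]
    with s h1 h2
  rw [Pi.sub_apply, h1, h2]
  by_cases hs : s ∈ Icc 0 t
  · simp [indicator_of_mem hs]
  · simp [indicator_of_notMem hs, StepFun.toFun_eq_zero (hσ n) hs]

/-- Uniqueness: the isometry sends every admissible approximating sequence to its elementary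
integrals, so the limit does not depend on the sequence. -/
lemma IsWienerIntegral.toLp_eq {l : ℕ} {t : ℝ} {g : ℝ → ℂ} {I : Ω → ℂ}
    (h : IsWienerIntegral P (W.β l) t g I) :
    h.2.1.toLp = W.wienerIsometry l (memLp_halfLine_indicator.2 h.1).toLp := by
  obtain ⟨hg, hI, σ, hσ, h1, h2⟩ := h
  have h3 := ((W.wienerIsometry l).continuous.tendsto _).comp (tendsto_toLpHalfLine hg hσ h1)
  refine tendsto_nhds_unique ?_ h3
  rw [Lp.tendsto_Lp_iff_tendsto_eLpNorm']
  refine h2.congr fun n => ?_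
  rw [← eLpNorm_neg]
  refine eLpNorm_congr_ae ?_
  filter_upwards [(σ n).coeFn_wienerIsometry W l, hI.coeFn_toLp] with ω h1 h2
  simp [h1, h2]

lemma isWienerIntegral_wienerIsometry (l : ℕ) {t : ℝ} (ht : 0 ≤ t) {g : ℝ → ℂ}
    (hg : MemLp g 2 (volume.restrict (Icc 0 t))) :
    IsWienerIntegral P (W.β l) t g
      (W.wienerIsometry l (memLp_halfLine_indicator.2 hg).toLp) := by
  lift t to ℝ≥0 using ht
  obtain ⟨σ, hσ, hlim⟩ := exists_stepFun_tendsto t hg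
  refine ⟨hg, Lp.memLp _, σ, hσ, hlim, ?_⟩
  have h3 := ((W.wienerIsometry l).continuous.tendsto _).comp (tendsto_toLpHalfLine hg hσ hlim)
  rw [Lp.tendsto_Lp_iff_tendsto_eLpNorm'] at h3
  refine h3.congr fun n => ?_
  rw [← eLpNorm_neg]
  refine eLpNorm_congr_ae ?_
  filter_upwards [(σ n).coeFn_wienerIsometry W l] with ω h1
  simp [h1]

end IsWienerIntegral

/-! ### Modulation and the Fourier transform on `L²(ℝ)` -/

lemma iteratedDeriv_cexp_mul_ofReal (c : ℂ) (n : ℕ) :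
    iteratedDeriv n (fun ξ : ℝ => Complex.exp (c * ξ)) = fun ξ : ℝ => c ^ n * Complex.exp (c * ξ) := by
  induction n with
  | zero => simp
  | succ n ih =>
    rw [iteratedDeriv_succ, ih]
    ext ξ
    have h : HasDerivAt (fun ξ : ℝ => c * (ξ : ℂ)) c ξ := by
      simpa using (Complex.ofRealCLM.hasDerivAt (x := ξ)).const_mul c
    rw [(h.cexp.const_mul (c ^ n)).deriv]
    ring

/-- The character `ξ ↦ exp(2πiξx)`. -/
def modChar (x ξ : ℝ) : ℂ := Complex.exp (2 * Real.pi * Complex.I * x * ξ)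

lemma norm_modChar (x ξ : ℝ) : ‖modChar x ξ‖ = 1 := by
  rw [modChar, show 2 * (Real.pi : ℂ) * Complex.I * x * ξ =
    ((2 * Real.pi * x * ξ : ℝ) : ℂ) * Complex.I by push_cast; ring]
  exact Complex.norm_exp_ofReal_mul_I _

@[fun_prop]
lemma continuous_modChar (x : ℝ) : Continuous (modChar x) := by
  unfold modChar; fun_prop

lemma hasTemperateGrowth_modChar (x : ℝ) : (modChar x).HasTemperateGrowth := by
  refine ⟨?_, fun n => ⟨0, ‖(2 * Real.pi * Complex.I * x : ℂ) ^ n‖, fun ξ => ?_⟩⟩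
  · unfold modChar
    exact (contDiff_const.mul Complex.ofRealCLM.contDiff).cexp
  · rw [norm_iteratedFDeriv_eq_norm_iteratedDeriv]
    have : modChar x = fun ξ : ℝ => Complex.exp (2 * Real.pi * Complex.I * x * ξ) := rfl
    rw [this, iteratedDeriv_cexp_mul_ofReal, norm_mul, show ‖Complex.exp
      (2 * Real.pi * Complex.I * x * ξ)‖ = 1 from norm_modChar x ξ]
    simp

lemma MeasureTheory.MemLp.modChar_mul {φ : ℝ → ℂ} (hφ : MemLp φ 2 volume) (x : ℝ) :
    MemLp (fun ξ => modChar x ξ * φ ξ) 2 volume :=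
  hφ.of_le ((continuous_modChar x).aestronglyMeasurable.mul hφ.1)
    (ae_of_all _ fun ξ => by rw [norm_mul, norm_modChar, one_mul])

/-- Multiplication by the character `modChar x` on `L²(ℝ)`. -/
def modulation (x : ℝ) (φ : Lp ℂ 2 (volume : Measure ℝ)) : Lp ℂ 2 (volume : Measure ℝ) :=
  ((Lp.memLp φ).modChar_mul x).toLp

lemma coeFn_modulation (x : ℝ) (φ : Lp ℂ 2 (volume : Measure ℝ)) :
    modulation x φ =ᵐ[volume] fun ξ => modChar x ξ * φ ξ := MemLp.coeFn_toLp _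

lemma isometry_modulation (x : ℝ) : Isometry (modulation x) := by
  intro φ ψ
  rw [modulation, modulation, Lp.edist_toLp_toLp, Lp.edist_def]
  refine eLpNorm_congr_norm_ae (ae_of_all _ fun ξ => ?_)
  simp [← mul_sub, norm_modChar]

/-- The reflection `y ↦ x - y` turns the inverse transform into the forward one, and the shift by
`x` becomes a modulation. -/
lemma fourierInv_comp_sub_schwartz (x y : ℝ) (s : SchwartzMap ℝ ℂ) :
    (𝓕⁻ s) (x - y) = (𝓕 (SchwartzMap.smulLeftCLM ℂ (modChar x) s)) y := by
  rw [SchwartzMap.fourierInv_coe, SchwartzMap.fourier_coe, Real.fourierInv_eq', Real.fourier_eq']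
  refine integral_congr_ae (ae_of_all _ fun ξ => ?_)
  simp only [SchwartzMap.smulLeftCLM_apply_apply (hasTemperateGrowth_modChar x), smul_eq_mul,
    modChar, RCLike.inner_apply, conj_trivial]
  rw [← mul_assoc (Complex.exp _), ← Complex.exp_add]
  congr 2
  push_cast
  ring

/-- Both sides are continuous in `φ` for the `L²` norm, so the Schwartz case suffices. -/
lemma fourierInv_comp_sub (x : ℝ) (φ : Lp ℂ 2 (volume : Measure ℝ)) :
    (fun y => (𝓕⁻ φ : Lp ℂ 2 (volume : Measure ℝ)) (x - y)) =ᵐ[volume]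
      (𝓕 (modulation x φ) : Lp ℂ 2 (volume : Measure ℝ)) := by
  have hmp := Measure.measurePreserving_sub_left (volume : Measure ℝ) x
  have key : Lp.compMeasurePreserving _ hmp (𝓕⁻ φ : Lp ℂ 2 (volume : Measure ℝ)) =
      𝓕 (modulation x φ) := by
    refine DenseRange.induction_on (p := fun φ => Lp.compMeasurePreserving _ hmp
        (𝓕⁻ φ : Lp ℂ 2 (volume : Measure ℝ)) = 𝓕 (modulation x φ))
      (SchwartzMap.denseRange_toLpCLM (E := ℝ) (F := ℂ) (p := 2) (μ := volume)
        ENNReal.ofNat_ne_top) φ ?_ fun s => ?_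
    · refine isClosed_eq ?_ ?_
      · exact (Lp.isometry_compMeasurePreserving hmp).continuous.comp
          (Lp.fourierTransformₗᵢ ℝ ℂ).symm.continuous
      · exact (Lp.fourierTransformₗᵢ ℝ ℂ).continuous.comp (isometry_modulation x).continuous
    · rw [SchwartzMap.toLpCLM_apply]
      have hm : modulation x (s.toLp 2) = (SchwartzMap.smulLeftCLM ℂ (modChar x) s).toLp 2 := by
        refine Lp.ext ?_
        filter_upwards [coeFn_modulation x (s.toLp 2), s.coeFn_toLp 2 volume,
          (SchwartzMap.smulLeftCLM ℂ (modChar x) s).coeFn_toLp 2 volume] with ξ h1 h2 h3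
        rw [h1, h2, h3, SchwartzMap.smulLeftCLM_apply_apply (hasTemperateGrowth_modChar x),
          smul_eq_mul]
      rw [hm, SchwartzMap.toLp_fourier_eq, SchwartzMap.toLp_fourierInv_eq]
      refine Lp.ext ?_
      filter_upwards [Lp.coeFn_compMeasurePreserving ((𝓕⁻ s).toLp 2) hmp,
        hmp.quasiMeasurePreserving.ae ((𝓕⁻ s).coeFn_toLp 2 volume),
        (𝓕 (SchwartzMap.smulLeftCLM ℂ (modChar x) s)).coeFn_toLp 2 volume] with y h1 h2 h3
      rw [h1, h3, Function.comp_apply, h2, fourierInv_comp_sub_schwartz]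
  rw [← key]
  exact (Lp.coeFn_compMeasurePreserving _ hmp).symm

lemma inner_star_star (a b : Lp ℂ 2 (volume : Measure ℝ)) :
    inner ℂ (star a) (star b) = inner ℂ b a := by
  rw [L2.inner_def, L2.inner_def]
  refine integral_congr_ae ?_
  filter_upwards [Lp.coeFn_star a, Lp.coeFn_star b] with y h1 h2
  rw [h1, h2]
  simp [RCLike.inner_apply, mul_comm]

/-- The function `𝓕⁻ ē`, which represents `φ ↦ ∫ (𝓕 φ) e`. -/
def dualFreq (e : Lp ℂ 2 (volume : Measure ℝ)) : Lp ℂ 2 (volume : Measure ℝ) := 𝓕⁻ (star e)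

/-- Conjugation is antiunitary and the inverse Fourier transform unitary. -/
lemma orthonormal_dualFreq {ι : Type*} {e : ι → Lp ℂ 2 (volume : Measure ℝ)}
    (he : Orthonormal ℂ e) : Orthonormal ℂ fun i => dualFreq (e i) := by
  classical
  have h (i j) : inner ℂ (dualFreq (e i)) (dualFreq (e j)) = inner ℂ (e j) (e i) := by
    rw [← inner_star_star (e i) (e j)]
    exact (Lp.fourierTransformₗᵢ ℝ ℂ).symm.inner_map_map _ _
  rw [orthonormal_iff_ite] at he ⊢
  intro i j
  rw [h, he]
  simp [eq_comm]

/-- Plancherel: the convolution with a basis vector becomes a pairing in frequency, where `x` enters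
only through a unimodular factor. -/
lemma integral_fourierInv_sub_mul (x : ℝ) (φ e : Lp ℂ 2 (volume : Measure ℝ)) :
    ∫ y, (𝓕⁻ φ : Lp ℂ 2 (volume : Measure ℝ)) (x - y) * e y =
      inner ℂ (dualFreq e) (modulation x φ) := by
  have h : inner ℂ (dualFreq e) (modulation x φ) = inner ℂ (star e) (𝓕 (modulation x φ)) := by
    rw [← Lp.inner_fourier_eq, dualFreq, FourierTransform.fourier_fourierInv_eq]
  rw [h, L2.inner_def]
  refine integral_congr_ae ?_
  filter_upwards [fourierInv_comp_sub x φ, Lp.coeFn_star e] with y h1 h2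
  rw [h1, h2]
  simp [RCLike.inner_apply]

/-! ### Coefficients of a square integrable field -/

/-- The coefficient `⟨E, F(τ, ·)⟩`. -/
def coeff (E : Lp ℂ 2 (volume : Measure ℝ)) (F : ℝ × ℝ → ℂ) (τ : ℝ) : ℂ :=
  ∫ ξ, inner ℂ (E ξ) (F (τ, ξ))

section coeff

variable {μ : Measure ℝ} {F G : ℝ × ℝ → ℂ}

lemma coeff_eq_inner (E : Lp ℂ 2 (volume : Measure ℝ)) {τ : ℝ}
    (h : MemLp (fun ξ => F (τ, ξ)) 2 volume) : coeff E F τ = inner ℂ E h.toLp := by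
  rw [coeff, L2.inner_def]
  refine integral_congr_ae ?_
  filter_upwards [h.coeFn_toLp] with ξ hξ
  rw [hξ]

lemma eLpNorm_two_sq {α E : Type*} [MeasurableSpace α] [NormedAddCommGroup E] (f : α → E)
    (m : Measure α) : eLpNorm f 2 m ^ 2 = ∫⁻ x, ‖f x‖ₑ ^ 2 ∂m := by
  have := eLpNorm_nnreal_pow_eq_lintegral (f := f) (μ := m) (p := 2) (by norm_num)
  simpa using this

lemma eLpNorm_prod_sq (hF : AEStronglyMeasurable F (μ.prod volume)) :
    eLpNorm F 2 (μ.prod volume) ^ 2 = ∫⁻ τ, (∫⁻ ξ, ‖F (τ, ξ)‖ₑ ^ 2) ∂μ := by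
  rw [eLpNorm_two_sq, lintegral_prod _ (by fun_prop)]

lemma aestronglyMeasurable_coeff (E : Lp ℂ 2 (volume : Measure ℝ))
    (hF : AEStronglyMeasurable F (μ.prod volume)) : AEStronglyMeasurable (coeff E F) μ := by
  have hE : AEStronglyMeasurable (fun z : ℝ × ℝ => E z.2) (μ.prod volume) :=
    (Lp.aestronglyMeasurable E).comp_snd
  exact (hE.inner (𝕜 := ℂ) hF).integral_prod_right'

lemma MeasureTheory.MemLp.ae_slice (hF : MemLp F 2 (μ.prod volume)) :
    ∀ᵐ τ ∂μ, MemLp (fun ξ => F (τ, ξ)) 2 volume := by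
  have h1 : ∫⁻ τ, (∫⁻ ξ, ‖F (τ, ξ)‖ₑ ^ 2) ∂μ ≠ ∞ := by
    rw [← eLpNorm_prod_sq hF.1]
    exact ENNReal.pow_ne_top hF.2.ne
  have h2 : AEMeasurable (fun z => ‖F z‖ₑ ^ 2) (μ.prod volume) := hF.1.enorm.pow_const 2
  filter_upwards [ae_lt_top' h2.lintegral_prod_right' h1, hF.1.prodMk_left] with τ h3 h4
  refine ⟨h4, ?_⟩
  rw [← eLpNorm_two_sq] at h3
  by_contra h
  rw [not_lt, top_le_iff] at h
  simp [h] at h3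

lemma coeff_sub_ae (E : Lp ℂ 2 (volume : Measure ℝ)) (hF : MemLp F 2 (μ.prod volume))
    (hG : MemLp G 2 (μ.prod volume)) : coeff E (F - G) =ᵐ[μ] coeff E F - coeff E G := by
  filter_upwards [hF.ae_slice, hG.ae_slice] with τ h1 h2
  have h3 : MemLp (fun ξ => (F - G) (τ, ξ)) 2 volume := h1.sub h2
  rw [coeff_eq_inner E h3, Pi.sub_apply, coeff_eq_inner E h1, coeff_eq_inner E h2, ← inner_sub_right]
  congr 1

/-- Bessel's inequality, integrated in time. -/
lemma sum_eLpNorm_coeff_sq_le {ι : Type*} {E : ι → Lp ℂ 2 (volume : Measure ℝ)}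
    (hE : Orthonormal ℂ E) (hF : MemLp F 2 (μ.prod volume)) (s : Finset ι) :
    ∑ i ∈ s, eLpNorm (coeff (E i) F) 2 μ ^ 2 ≤ eLpNorm F 2 (μ.prod volume) ^ 2 := by
  simp_rw [eLpNorm_two_sq]
  rw [← lintegral_finsetSum', lintegral_prod _ (hF.1.enorm.pow_const 2)]
  · refine lintegral_mono_ae ?_
    filter_upwards [hF.ae_slice] with τ h
    rw [← eLpNorm_two_sq (fun ξ => F (τ, ξ)), ← Lp.enorm_toLp h]
    have h1 := hE.sum_inner_products_le (s := s) h.toLp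
    have h2 := ENNReal.ofReal_le_ofReal h1
    rw [ENNReal.ofReal_sum_of_nonneg (fun i _ => by positivity)] at h2
    simpa only [ENNReal.ofReal_pow (norm_nonneg _), ofReal_norm, coeff_eq_inner _ h] using h2
  · exact fun i _ => (aestronglyMeasurable_coeff (E i) hF.1).enorm.pow_const 2

lemma memLp_coeff {E : Lp ℂ 2 (volume : Measure ℝ)} (hE : ‖E‖ = 1)
    (hF : MemLp F 2 (μ.prod volume)) : MemLp (coeff E F) 2 μ := by
  refine ⟨aestronglyMeasurable_coeff E hF.1, ?_⟩
  have hE' : Orthonormal ℂ (fun _ : Unit => E) :=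
    ⟨fun _ => hE, fun i j hij => (hij (Subsingleton.elim _ _)).elim⟩
  have := sum_eLpNorm_coeff_sq_le hE' hF Finset.univ
  simp only [Finset.univ_unique, Finset.sum_const, Finset.card_singleton, one_smul] at this
  by_contra h
  rw [not_lt, top_le_iff] at h
  rw [h] at this
  exact (ENNReal.pow_ne_top hF.2.ne) (top_le_iff.1 (by simpa only [ENNReal.top_pow two_ne_zero] using this))

end coeff

/-! ### The stochastic convolution -/

/-- The field `(τ, ξ) ↦ 1_{[0, t]}(τ) f(t - τ, 2πξ) exp(2πiξx)`. -/
def freqField (f : ℝ → ℝ → ℂ) (t x : ℝ) (z : ℝ × ℝ) : ℂ :=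
  (Icc 0 t).indicator (fun τ => modChar x z.2 * f (t - τ) (2 * Real.pi * z.2)) z.1

lemma modChar_neg_mul (x ξ : ℝ) : modChar (-x) ξ * modChar x ξ = 1 := by
  rw [modChar, modChar, ← Complex.exp_add, ← Complex.exp_zero]
  congr 1
  push_cast
  ring

/-- Almost every slice of the field is square integrable, so for almost every `τ` in `[0, t]` the
kernel is the genuine inverse transform and not the default `0`; outside `[0, t]` both sides vanish.
-/
lemma integral_greenKernel_mul_ae (f : ℝ → ℝ → ℂ) (t x : ℝ) (e : Lp ℂ 2 (volume : Measure ℝ))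
    (hF : MemLp (freqField f t x) 2 (halfLine.prod volume)) :
    (Icc 0 t).indicator (fun τ => ∫ y, greenKernel f (t - τ) (x - y) * e y) =ᵐ[halfLine]
      coeff (dualFreq e) (freqField f t x) := by
  filter_upwards [hF.ae_slice] with τ hτ
  by_cases h : τ ∈ Icc 0 t
  · have hs : (fun ξ => freqField f t x (τ, ξ)) =
        fun ξ => modChar x ξ * f (t - τ) (2 * Real.pi * ξ) := by
      ext ξ
      rw [freqField, indicator_of_mem h]
    have hφ : MemLp (fun ξ : ℝ => f (t - τ) (2 * Real.pi * ξ)) 2 volume := by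
      -- Modulating by `-x` recovers `f(t - τ, 2π·)` from the slice.
      have h2 := hτ.modChar_mul (-x)
      simp only [freqField, indicator_of_mem h, ← mul_assoc, modChar_neg_mul, one_mul] at h2
      simpa only [mul_assoc] using h2
    rw [indicator_of_mem h, coeff_eq_inner _ hτ, greenKernel, dif_pos hφ,
      integral_fourierInv_sub_mul]
    congr 1
    refine Lp.ext ?_
    filter_upwards [coeFn_modulation x hφ.toLp, hφ.coeFn_toLp, hτ.coeFn_toLp] with ξ h1 h2 h3
    rw [h1, h2, h3, freqField, indicator_of_mem h]
  · rw [indicator_of_notMem h, coeff]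
    simp [freqField, h]

namespace ComplexCylindricalWiener

variable {Ω : Type*} [MeasurableSpace Ω] {P : Measure Ω} (W : ComplexCylindricalWiener P)

lemma orthonormal_dualFreq_e : Orthonormal ℂ fun l => dualFreq (W.e l) :=
  orthonormal_dualFreq W.e.orthonormal

/-- The coefficients of a field with respect to the basis `dualFreq (W.e l)`, as elements of
`L²([0, ∞))`. -/
def fieldCoeff {F : ℝ × ℝ → ℂ} (hF : MemLp F 2 (halfLine.prod volume)) (l : ℕ) :
    Lp ℂ 2 halfLine :=
  (memLp_coeff (W.orthonormal_dualFreq_e.1 l) hF).toLp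

lemma fieldCoeff_sub {F G : ℝ × ℝ → ℂ} (hF : MemLp F 2 (halfLine.prod volume))
    (hG : MemLp G 2 (halfLine.prod volume)) (l : ℕ) :
    W.fieldCoeff (hF.sub hG) l = W.fieldCoeff hF l - W.fieldCoeff hG l := by
  rw [fieldCoeff, fieldCoeff, fieldCoeff, ← MemLp.toLp_sub]
  exact MemLp.toLp_congr _ _ (coeff_sub_ae _ hF hG)

lemma sum_norm_fieldCoeff_sq_le {F : ℝ × ℝ → ℂ} (hF : MemLp F 2 (halfLine.prod volume))
    (s : Finset ℕ) :
    ∑ l ∈ s, ‖W.fieldCoeff hF l‖ ^ 2 ≤ (eLpNorm F 2 (halfLine.prod volume)).toReal ^ 2 := by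
  have h := ENNReal.toReal_mono (ENNReal.pow_ne_top hF.2.ne)
    (sum_eLpNorm_coeff_sq_le W.orthonormal_dualFreq_e hF s)
  rw [ENNReal.toReal_sum (fun l _ => ENNReal.pow_ne_top
    (memLp_coeff (W.orthonormal_dualFreq_e.1 l) hF).2.ne)] at h
  simpa [fieldCoeff, Lp.norm_toLp] using h

variable [IsProbabilityMeasure P]

/-- `X` is the stochastic integral of the field `F` against the cylindrical Wiener process, given
by its expansion in the basis of `W`. -/
def IsFieldIntegral {F : ℝ × ℝ → ℂ} (hF : MemLp F 2 (halfLine.prod volume)) (X : Lp ℂ 2 P) :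
    Prop :=
  Tendsto (fun n => ∑ l ∈ Finset.range n, W.wienerIsometry l (W.fieldCoeff hF l)) atTop (𝓝 X)

/-- The terms are pairwise orthogonal, and their squared norms are summable by Bessel's inequality.
-/
lemma exists_isFieldIntegral {F : ℝ × ℝ → ℂ} (hF : MemLp F 2 (halfLine.prod volume)) :
    ∃ X, W.IsFieldIntegral hF X := by
  have : Summable fun l => W.wienerIsometry l (W.fieldCoeff hF l) := by
    rw [W.orthogonalFamily_wienerIsometry.summable_iff_norm_sq_summable]
    exact summable_of_sum_le (fun _ => by positivity) (W.sum_norm_fieldCoeff_sq_le hF)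
  exact ⟨_, this.hasSum.tendsto_sum_nat⟩

variable {W}

lemma IsFieldIntegral.sub {F G : ℝ × ℝ → ℂ} {hF : MemLp F 2 (halfLine.prod volume)}
    {hG : MemLp G 2 (halfLine.prod volume)} {X Y : Lp ℂ 2 P} (hX : W.IsFieldIntegral hF X)
    (hY : W.IsFieldIntegral hG Y) : W.IsFieldIntegral (hF.sub hG) (X - Y) := by
  refine (Tendsto.sub hX hY).congr fun n => ?_
  rw [← Finset.sum_sub_distrib]
  exact Finset.sum_congr rfl fun l _ => by rw [W.fieldCoeff_sub hF hG, map_sub]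

/-- Pythagoras for the partial sums, then Bessel. -/
lemma IsFieldIntegral.norm_le {F : ℝ × ℝ → ℂ} {hF : MemLp F 2 (halfLine.prod volume)}
    {X : Lp ℂ 2 P} (hX : W.IsFieldIntegral hF X) :
    ‖X‖ ≤ (eLpNorm F 2 (halfLine.prod volume)).toReal := by
  refine le_of_tendsto hX.norm (Eventually.of_forall fun n => ?_)
  refine le_of_sq_le_sq ?_ ENNReal.toReal_nonneg
  rw [W.orthogonalFamily_wienerIsometry.norm_sum]
  exact W.sum_norm_fieldCoeff_sq_le hF _

lemma IsFieldIntegral.mem_gaussianSpace {F : ℝ × ℝ → ℂ} {hF : MemLp F 2 (halfLine.prod volume)}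
    {X : Lp ℂ 2 P} (hX : W.IsFieldIntegral hF X) : X ∈ W.gaussianSpace :=
  (Submodule.isClosed_topologicalClosure _).mem_of_tendsto hX
    (Eventually.of_forall fun _ => Submodule.sum_mem _ fun l _ =>
      W.wienerIsometry_mem_gaussianSpace l _)

end ComplexCylindricalWiener

section IsStochConvAt

variable {Ω : Type*} [MeasurableSpace Ω] {P : Measure Ω} {W : ComplexCylindricalWiener P}
  {f : ℝ → ℝ → ℂ} {t x : ℝ} {Y Z : Ω → ℂ}

lemma IsStochConvAt.congr (h : IsStochConvAt W f t x Y) (hYZ : Y =ᵐ[P] Z) :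
    IsStochConvAt W f t x Z := by
  obtain ⟨hY, I, hI, hlim⟩ := h
  refine ⟨(memLp_congr_ae hYZ).1 hY, I, hI, hlim.congr fun n => eLpNorm_congr_ae ?_⟩
  filter_upwards [hYZ] with ω hω
  rw [hω]

variable [IsProbabilityMeasure P]

/-- Whatever version and whatever Wiener integrals `I l` are used, the class in `L²(P)` is that of
the field integral. Estimates thus hold for every version, and increments can be computed by
linearity in the field. -/
lemma IsStochConvAt.isFieldIntegral (h : IsStochConvAt W f t x Y)
    (hF : MemLp (freqField f t x) 2 (halfLine.prod volume)) :
    W.IsFieldIntegral hF h.1.toLp := by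
  obtain ⟨hY, I, hI, hlim⟩ := h
  have hIL (l : ℕ) : (hI l).2.1.toLp = W.wienerIsometry l (W.fieldCoeff hF l) := by
    rw [(hI l).toLp_eq W]
    congr 1
    exact MemLp.toLp_congr _ _ (integral_greenKernel_mul_ae f t x (W.e l) hF)
  rw [ComplexCylindricalWiener.IsFieldIntegral, Lp.tendsto_Lp_iff_tendsto_eLpNorm']
  refine hlim.congr fun n => ?_
  rw [← eLpNorm_neg]
  refine eLpNorm_congr_ae ?_
  have h1 : ∀ᵐ ω ∂P, ∀ l, W.wienerIsometry l (W.fieldCoeff hF l) ω = I l ω := by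
    rw [ae_all_iff]
    intro l
    rw [← hIL l]
    exact (hI l).2.1.coeFn_toLp
  filter_upwards [h1, hY.coeFn_toLp, Lp.coeFn_finsetSum (Finset.range n)
    (fun l => W.wienerIsometry l (W.fieldCoeff hF l))] with ω h1 h2 h3
  rw [Pi.neg_apply, Pi.sub_apply, h3, h2, Finset.sum_apply, neg_sub]
  simp only [h1]

lemma exists_isStochConvAt (W : ComplexCylindricalWiener P) (ht : 0 ≤ t)
    (hF : MemLp (freqField f t x) 2 (halfLine.prod volume)) : ∃ Y, IsStochConvAt W f t x Y := by
  obtain ⟨X, hX⟩ := W.exists_isFieldIntegral hF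
  have hg (l : ℕ) : MemLp (fun τ => ∫ y, greenKernel f (t - τ) (x - y) * W.e l y) 2
      (volume.restrict (Icc 0 t)) := by
    rw [← memLp_halfLine_indicator]
    exact (memLp_congr_ae (integral_greenKernel_mul_ae f t x (W.e l) hF)).2
      (memLp_coeff (W.orthonormal_dualFreq_e.1 l) hF)
  refine ⟨X, Lp.memLp X, fun l => W.wienerIsometry l (memLp_halfLine_indicator.2 (hg l)).toLp,
    fun l => isWienerIntegral_wienerIsometry W l ht (hg l), ?_⟩
  rw [ComplexCylindricalWiener.IsFieldIntegral, Lp.tendsto_Lp_iff_tendsto_eLpNorm'] at hX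
  refine hX.congr fun n => ?_
  rw [← eLpNorm_neg]
  refine eLpNorm_congr_ae ?_
  have hIL (l : ℕ) : (memLp_halfLine_indicator.2 (hg l)).toLp = W.fieldCoeff hF l :=
    MemLp.toLp_congr _ _ (integral_greenKernel_mul_ae f t x (W.e l) hF)
  filter_upwards [Lp.coeFn_finsetSum (Finset.range n)
    (fun l => W.wienerIsometry l (W.fieldCoeff hF l))] with ω h3
  rw [Pi.neg_apply, Pi.sub_apply, h3, Finset.sum_apply, neg_sub]
  simp only [hIL]

end IsStochConvAt

/-- Moment bounds for the stochastic convolution and for its increments. -/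
theorem exists_eLpNorm_stochConv_le (q : ℝ≥0∞) (hq : q ≠ ∞) (hq1 : 1 ≤ q) :
    ∃ C : ℝ≥0, ∀ {Ω : Type*} [MeasurableSpace Ω] (P : Measure Ω) [IsProbabilityMeasure P]
      (W : ComplexCylindricalWiener P) (f : ℝ → ℝ → ℂ) (t x : ℝ) (Y : Ω → ℂ),
      IsStochConvAt W f t x Y → MemLp (freqField f t x) 2 (halfLine.prod volume) →
      eLpNorm Y q P ≤ C * eLpNorm (freqField f t x) 2 (halfLine.prod volume) ∧
      ∀ (s y : ℝ) (Z : Ω → ℂ), IsStochConvAt W f s y Z →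
        MemLp (freqField f s y) 2 (halfLine.prod volume) →
        eLpNorm (Y - Z) q P ≤
          C * eLpNorm (freqField f t x - freqField f s y) 2 (halfLine.prod volume) := by
  obtain ⟨C, hC⟩ := exists_eLpNorm_le_of_mem_gaussianSpace q hq hq1
  have key {Ω : Type _} [MeasurableSpace Ω] (P : Measure Ω) [IsProbabilityMeasure P]
      (W : ComplexCylindricalWiener P) {F : ℝ × ℝ → ℂ} (hF : MemLp F 2 (halfLine.prod volume))
      (X : Lp ℂ 2 P) (hX : W.IsFieldIntegral hF X) :
      eLpNorm X q P ≤ C * eLpNorm F 2 (halfLine.prod volume) := by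
    refine (hC P W X hX.mem_gaussianSpace).trans ?_
    gcongr
    rw [← Lp.enorm_def, ← ofReal_norm]
    exact ENNReal.ofReal_le_of_le_toReal hX.norm_le
  refine ⟨C, fun {Ω} _ P _ W f t x Y hY hF => ⟨?_, fun s y Z hZ hG => ?_⟩⟩
  · rw [← eLpNorm_congr_ae hY.1.coeFn_toLp]
    exact key P W hF _ (hY.isFieldIntegral hF)
  · have h := key P W (hF.sub hG) _ ((hY.isFieldIntegral hF).sub (hZ.isFieldIntegral hG))
    refine le_trans (le_of_eq (eLpNorm_congr_ae ?_)) h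
    filter_upwards [hY.1.coeFn_toLp, hZ.1.coeFn_toLp, Lp.coeFn_sub hY.1.toLp hZ.1.toLp]
      with ω h1 h2 h3
    rw [h3, Pi.sub_apply, Pi.sub_apply, h1, h2]

/-! ### Estimates for the frequency field -/

lemma MeasureTheory.Measure.QuasiMeasurePreserving.prodMap_of_sfinite {α β α' β' : Type*}
    [MeasurableSpace α] [MeasurableSpace β] [MeasurableSpace α'] [MeasurableSpace β']
    {μ : Measure α} {ν : Measure β} {μ' : Measure α'} {ν' : Measure β'} [SFinite μ] [SFinite ν]
    [SFinite μ'] [SFinite ν'] {g : α → α'} {h : β → β'} (hg : QuasiMeasurePreserving g μ μ')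
    (hh : QuasiMeasurePreserving h ν ν') :
    QuasiMeasurePreserving (Prod.map g h) (μ.prod ν) (μ'.prod ν') := by
  refine ⟨hg.measurable.prodMap hh.measurable, ?_⟩
  rw [← Measure.map_prod_map _ _ hg.measurable hh.measurable]
  exact hg.absolutelyContinuous.prod hh.absolutelyContinuous

lemma quasiMeasurePreserving_two_pi_mul :
    Measure.QuasiMeasurePreserving (fun ξ : ℝ => 2 * Real.pi * ξ) volume volume := by
  refine ⟨by fun_prop, ?_⟩
  rw [Real.map_volume_mul_left (by positivity)]
  exact Measure.smul_absolutelyContinuous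

/-- The change of variables produces the factor `1 / (2π) ≤ 1`, which is discarded. -/
lemma lintegral_comp_two_pi_mul_le (g : ℝ → ℝ≥0∞) :
    ∫⁻ ξ, g (2 * Real.pi * ξ) ≤ ∫⁻ k, g k := by
  have hne : 2 * Real.pi ≠ 0 := by positivity
  have h := lintegral_map_equiv (μ := volume) g (Homeomorph.mulLeft₀ _ hne).toMeasurableEquiv
  simp only [Homeomorph.toMeasurableEquiv_coe, Homeomorph.coe_mulLeft₀] at h
  rw [Real.map_volume_mul_left hne, lintegral_smul_measure] at h
  rw [← h, smul_eq_mul]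
  refine mul_le_of_le_one_left zero_le ?_
  rw [ENNReal.ofReal_le_one, abs_of_pos (by positivity)]
  exact inv_le_one_of_one_le₀ (by nlinarith [Real.pi_gt_three])

lemma setLIntegral_Icc_sub_left (N : ℝ → ℝ≥0∞) (a b t : ℝ) :
    ∫⁻ τ in Icc a b, N (t - τ) = ∫⁻ τ in Icc (t - b) (t - a), N τ := by
  have h := (Measure.measurePreserving_sub_left (volume : Measure ℝ) t).setLIntegral_comp_preimage_emb
    (Homeomorph.subLeft t).measurableEmbedding N (Icc (t - b) (t - a))
  rw [← h]
  congr 2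
  ext τ
  simp only [mem_Icc, mem_preimage]
  constructor <;> intro h <;> constructor <;> linarith [h.1, h.2]

lemma quasiMeasurePreserving_sub_left_restrict {t T : ℝ} (htT : t ≤ T) :
    Measure.QuasiMeasurePreserving (fun τ : ℝ => t - τ) (volume.restrict (Icc 0 t))
      (volume.restrict (Icc 0 T)) := by
  have h := (Measure.measurePreserving_sub_left (volume : Measure ℝ) t).restrict_preimage
    (measurableSet_Icc (a := (0 : ℝ)) (b := t))
  have h2 : (fun τ : ℝ => t - τ) ⁻¹' Icc 0 t = Icc 0 t := by
    ext τ
    simp only [mem_Icc, mem_preimage]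
    constructor <;> intro h <;> constructor <;> linarith [h.1, h.2]
  rw [h2] at h
  exact h.quasiMeasurePreserving.mono_right
    (Measure.absolutelyContinuous_of_le (Measure.restrict_mono (Icc_subset_Icc_right htT) le_rfl))

section freqField

variable {f : ℝ → ℝ → ℂ} {T t s x y γ γ' : ℝ}

lemma freqField_apply (f : ℝ → ℝ → ℂ) (t x τ ξ : ℝ) : freqField f t x (τ, ξ) =
    (Icc 0 t).indicator (fun τ => modChar x ξ * f (t - τ) (2 * Real.pi * ξ)) τ := rfl

/-- `f` is only almost everywhere measurable, and only on `[0, T] × ℝ`; the substitution `(τ, ξ) ↦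
(t - τ, 2πξ)` is nonsingular and sends `[0, t]` into `[0, T]`. -/
lemma aestronglyMeasurable_freqField
    (hf : AEStronglyMeasurable (Function.uncurry f) ((volume.restrict (Icc 0 T)).prod volume))
    (htT : t ≤ T) (x : ℝ) :
    AEStronglyMeasurable (freqField f t x) (halfLine.prod volume) := by
  have h1 := hf.comp_quasiMeasurePreserving
    ((quasiMeasurePreserving_sub_left_restrict htT).prodMap_of_sfinite quasiMeasurePreserving_two_pi_mul)
  have h2 : AEStronglyMeasurable (fun z : ℝ × ℝ => modChar x z.2)
      ((volume.restrict (Icc 0 t)).prod volume) :=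
    ((continuous_modChar x).comp continuous_snd).aestronglyMeasurable
  have h3 := h2.mul h1
  have hm : (volume.restrict (Icc 0 t)).prod (volume : Measure ℝ) =
      (halfLine.prod volume).restrict (Icc 0 t ×ˢ univ) := by
    rw [← Measure.prod_restrict, Measure.restrict_univ,
      halfLine_restrict Icc_subset_Ici_self measurableSet_Icc]
  rw [hm, ← aestronglyMeasurable_indicator_iff (measurableSet_Icc.prod .univ)] at h3
  refine h3.congr (ae_of_all _ fun z => ?_)
  by_cases h : z.1 ∈ Icc 0 t
  · rw [indicator_of_mem (show z ∈ Icc 0 t ×ˢ univ from ⟨h, trivial⟩), freqField,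
      indicator_of_mem h]
    rfl
  · rw [indicator_of_notMem (fun hz => h hz.1), freqField, indicator_of_notMem h]

lemma lintegral_indicator_halfLine (t : ℝ) (N : ℝ → ℝ≥0∞) :
    ∫⁻ τ, (Icc 0 t).indicator N τ ∂halfLine = ∫⁻ τ in Icc 0 t, N τ := by
  rw [lintegral_indicator measurableSet_Icc,
    halfLine_restrict Icc_subset_Ici_self measurableSet_Icc]

lemma eLpNorm_freqField_sq_le
    (hf : AEStronglyMeasurable (Function.uncurry f) ((volume.restrict (Icc 0 T)).prod volume))
    (htT : t ≤ T) (x γ : ℝ) :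
    eLpNorm (freqField f t x) 2 (halfLine.prod volume) ^ 2 ≤ normSqL2H γ T f := by
  rw [eLpNorm_prod_sq (aestronglyMeasurable_freqField hf htT x)]
  calc ∫⁻ τ, (∫⁻ ξ, ‖freqField f t x (τ, ξ)‖ₑ ^ 2) ∂halfLine
      ≤ ∫⁻ τ, (Icc 0 t).indicator (fun τ => ∫⁻ k, ‖f (t - τ) k‖ₑ ^ 2) τ ∂halfLine := by
        refine lintegral_mono fun τ => ?_
        by_cases h : τ ∈ Icc 0 t
        · rw [indicator_of_mem h]
          refine le_trans (le_of_eq ?_)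
            (lintegral_comp_two_pi_mul_le (fun k => ‖f (t - τ) k‖ₑ ^ 2))
          refine lintegral_congr fun ξ => ?_
          rw [freqField_apply, indicator_of_mem h, enorm_mul, ← ofReal_norm, norm_modChar,
            ENNReal.ofReal_one, one_mul]
        · simp [freqField_apply, h]
    _ = ∫⁻ τ in Icc 0 t, ∫⁻ k, ‖f τ k‖ₑ ^ 2 := by
        rw [lintegral_indicator_halfLine, setLIntegral_Icc_sub_left (fun τ => ∫⁻ k, ‖f τ k‖ₑ ^ 2)]
        simp
    _ ≤ normSqL2H γ T f := by
        refine (lintegral_mono_set (Icc_subset_Icc_right htT)).trans ?_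
        refine lintegral_mono fun τ => lintegral_mono fun k => le_mul_of_one_le_right zero_le ?_
        rw [ENNReal.one_le_ofReal]
        have : 0 ≤ |k| ^ (2 * γ) := by positivity
        linarith

lemma memLp_freqField
    (hf : AEStronglyMeasurable (Function.uncurry f) ((volume.restrict (Icc 0 T)).prod volume))
    (hfin : normSqL2H γ T f < ∞) (htT : t ≤ T) (x : ℝ) :
    MemLp (freqField f t x) 2 (halfLine.prod volume) := by
  refine ⟨aestronglyMeasurable_freqField hf htT x, ?_⟩
  have h := (eLpNorm_freqField_sq_le hf htT x γ).trans_lt hfin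
  by_contra h2
  rw [not_lt, top_le_iff] at h2
  simp [h2] at h

/-- Interpolation between the trivial bound `2` and the Lipschitz bound `r`, according to whether `r
≥ 1` or `r ≤ 1`. -/
lemma norm_modChar_sub_le (hγ0 : 0 < γ') (hγ1 : γ' ≤ 1) (x y ξ : ℝ) :
    ‖modChar x ξ - modChar y ξ‖ ≤ 2 * (|2 * Real.pi * ξ| * |x - y|) ^ γ' := by
  set r := |2 * Real.pi * ξ| * |x - y| with hr
  have hr0 : 0 ≤ r := by positivity
  have h1 : ‖modChar x ξ - modChar y ξ‖ ≤ 2 := by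
    refine (norm_sub_le _ _).trans ?_
    rw [norm_modChar, norm_modChar]; norm_num
  have h2 : ‖modChar x ξ - modChar y ξ‖ ≤ r := by
    have e : modChar x ξ - modChar y ξ =
        modChar y ξ * (Complex.exp (Complex.I * ((2 * Real.pi * ξ * (x - y) : ℝ) : ℂ)) - 1) := by
      rw [mul_sub, mul_one, modChar, modChar, ← Complex.exp_add]
      congr 2
      push_cast
      ring
    rw [e, norm_mul, norm_modChar, one_mul]
    refine (Real.norm_exp_I_mul_ofReal_sub_one_le).trans ?_
    rw [Real.norm_eq_abs, abs_mul, hr]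
  rcases le_total r 1 with h | h
  · refine h2.trans ?_
    have : r ^ (1 : ℝ) ≤ r ^ γ' := Real.rpow_le_rpow_of_exponent_ge' hr0 h hγ0.le hγ1
    rw [Real.rpow_one] at this
    linarith
  · refine h1.trans ?_
    have := Real.one_le_rpow h hγ0.le
    linarith

lemma rpow_le_rpow_add_one {a α β : ℝ} (ha : 0 ≤ a) (hα : 0 ≤ α) (h : α ≤ β) :
    a ^ α ≤ a ^ β + 1 := by
  rcases le_total a 1 with h1 | h1
  · have := Real.rpow_le_one ha h1 hα
    have : 0 ≤ a ^ β := by positivity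
    linarith
  · have := Real.rpow_le_rpow_of_exponent_le h1 h
    linarith

/-- The two fields differ only in their characters. Their difference yields `|x - y|^γ'` and a
frequency power `|k|^{2γ'} ≤ |k|^{2γ} + 1`, at most the weight in `normSqL2H`. -/
lemma eLpNorm_freqField_sub_space_sq_le
    (hf : AEStronglyMeasurable (Function.uncurry f) ((volume.restrict (Icc 0 T)).prod volume))
    (htT : t ≤ T) (hγ0 : 0 < γ') (hγ1 : γ' ≤ 1) (hγ : γ' ≤ γ) (x y : ℝ) :
    eLpNorm (freqField f t x - freqField f t y) 2 (halfLine.prod volume) ^ 2 ≤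
      ENNReal.ofReal (2 * |x - y| ^ γ') ^ 2 * normSqL2H γ T f := by
  set c := ENNReal.ofReal (2 * |x - y| ^ γ') ^ 2 with hc
  have hct : c ≠ ∞ := ENNReal.pow_ne_top ENNReal.ofReal_ne_top
  rw [eLpNorm_prod_sq ((aestronglyMeasurable_freqField hf htT x).sub
    (aestronglyMeasurable_freqField hf htT y))]
  let N : ℝ → ℝ≥0∞ := fun τ => ∫⁻ k, ‖f τ k‖ₑ ^ 2 * ENNReal.ofReal (|k| ^ (2 * γ) + 1)
  calc ∫⁻ τ, (∫⁻ ξ, ‖(freqField f t x - freqField f t y) (τ, ξ)‖ₑ ^ 2) ∂halfLine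
      ≤ ∫⁻ τ, (Icc 0 t).indicator (fun τ => c * N (t - τ)) τ ∂halfLine := by
        refine lintegral_mono fun τ => ?_
        by_cases h : τ ∈ Icc 0 t
        · rw [indicator_of_mem h, ← lintegral_const_mul' _ _ hct]
          refine le_trans (lintegral_mono fun ξ => ?_) (lintegral_comp_two_pi_mul_le _)
          rw [Pi.sub_apply, freqField_apply, freqField_apply, indicator_of_mem h,
            indicator_of_mem h, ← sub_mul, enorm_mul, mul_pow, mul_comm (_ ^ 2), mul_left_comm]
          refine mul_le_mul_right ?_ _
          rw [hc, ← ofReal_norm, ← ENNReal.ofReal_pow (by positivity),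
            ← ENNReal.ofReal_pow (by positivity), ← ENNReal.ofReal_mul (by positivity)]
          refine ENNReal.ofReal_le_ofReal ?_
          have h1 := norm_modChar_sub_le hγ0 hγ1 x y ξ
          rw [Real.mul_rpow (by positivity) (by positivity)] at h1
          set a := |2 * Real.pi * ξ| with ha
          have h2 : (a ^ γ') ^ 2 ≤ a ^ (2 * γ) + 1 := by
            rw [← Real.rpow_natCast, ← Real.rpow_mul (by positivity)]
            exact rpow_le_rpow_add_one (by positivity) (by positivity) (by push_cast; linarith)
          calc ‖modChar x ξ - modChar y ξ‖ ^ 2 ≤ (2 * (a ^ γ' * |x - y| ^ γ')) ^ 2 := by gcongr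
            _ = (2 * |x - y| ^ γ') ^ 2 * (a ^ γ') ^ 2 := by ring
            _ ≤ _ := by gcongr
        · simp [freqField_apply, h]
    _ = c * ∫⁻ τ in Icc 0 t, N τ := by
        rw [lintegral_indicator_halfLine, lintegral_const_mul' _ _ hct,
          setLIntegral_Icc_sub_left N]
        simp
    _ ≤ c * normSqL2H γ T f := by
        gcongr
        exact lintegral_mono_set (Icc_subset_Icc_right htT)

lemma le_ofReal_rpow_mul {δ a : ℝ} (hδ : 0 < δ) (A : ℝ≥0∞) :
    A = ENNReal.ofReal δ ^ a * (ENNReal.ofReal δ ^ (-a) * A) := by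
  rw [← mul_assoc, ← ENNReal.rpow_add _ _ (by simpa using hδ) ENNReal.ofReal_ne_top]
  simp

/-- Split at `τ = s`. On `(s, t]` the earlier field is zero, and reflection gives an integral over
`[0, t - s]`, controlled by the first supremum at `S = t - s`. On `[0, s]`, reflection about `s`
gives the second supremum at `S = t`, `R = s`. The common character has modulus one. -/
lemma eLpNorm_freqField_sub_time_sq_le
    (hf : AEStronglyMeasurable (Function.uncurry f) ((volume.restrict (Icc 0 T)).prod volume))
    (hs : 0 ≤ s) (hst : s < t) (htT : t ≤ T) (x γ : ℝ) :
    eLpNorm (freqField f t x - freqField f s x) 2 (halfLine.prod volume) ^ 2 ≤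
      ENNReal.ofReal (t - s) ^ (2 * γ) * normSqK γ T f := by
  rw [eLpNorm_prod_sq ((aestronglyMeasurable_freqField hf htT x).sub
    (aestronglyMeasurable_freqField hf (hst.le.trans htT) x))]
  let M : ℝ → ℝ≥0∞ := fun τ => ∫⁻ k, ‖f (t - s + τ) k - f τ k‖ₑ ^ 2
  let N : ℝ → ℝ≥0∞ := fun τ => ∫⁻ k, ‖f τ k‖ₑ ^ 2
  have hδ : 0 < t - s := sub_pos.2 hst
  calc ∫⁻ τ, (∫⁻ ξ, ‖(freqField f t x - freqField f s x) (τ, ξ)‖ₑ ^ 2) ∂halfLine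
      ≤ ∫⁻ τ in Icc 0 t, (∫⁻ ξ, ‖(freqField f t x - freqField f s x) (τ, ξ)‖ₑ ^ 2) := by
        rw [← lintegral_indicator_halfLine]
        refine lintegral_mono fun τ => ?_
        by_cases h : τ ∈ Icc 0 t
        · rw [indicator_of_mem h]
        · have h' : τ ∉ Icc 0 s := fun h2 => h ⟨h2.1, h2.2.trans hst.le⟩
          simp [freqField_apply, h, h']
    _ ≤ (∫⁻ τ in Icc s t, N (t - τ)) + ∫⁻ τ in Icc 0 s, M (s - τ) := by
        have hu : Icc 0 t = Ioc s t ∪ Icc 0 s := by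
          rw [union_comm, Icc_union_Ioc_eq_Icc hs hst.le]
        rw [hu]
        refine (lintegral_union_le _ _ _).trans (add_le_add ?_ ?_)
        · refine le_trans (setLIntegral_mono' measurableSet_Ioc fun τ hτ => ?_)
            (lintegral_mono_set Ioc_subset_Icc_self)
          refine le_trans (le_of_eq ?_)
            (lintegral_comp_two_pi_mul_le (fun k => ‖f (t - τ) k‖ₑ ^ 2))
          refine lintegral_congr fun ξ => ?_
          have h1 : τ ∈ Icc 0 t := ⟨hs.trans hτ.1.le, hτ.2⟩
          have h2 : τ ∉ Icc 0 s := fun h => not_le.2 hτ.1 h.2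
          rw [Pi.sub_apply, freqField_apply, freqField_apply, indicator_of_mem h1,
            indicator_of_notMem h2, sub_zero, enorm_mul, ← ofReal_norm, norm_modChar,
            ENNReal.ofReal_one, one_mul]
        · refine setLIntegral_mono' measurableSet_Icc fun τ hτ => ?_
          refine le_trans (le_of_eq ?_) (lintegral_comp_two_pi_mul_le
            (fun k => ‖f (t - s + (s - τ)) k - f (s - τ) k‖ₑ ^ 2))
          refine lintegral_congr fun ξ => ?_
          have h1 : τ ∈ Icc 0 t := ⟨hτ.1, hτ.2.trans hst.le⟩
          rw [Pi.sub_apply, freqField_apply, freqField_apply, indicator_of_mem h1,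
            indicator_of_mem hτ, ← mul_sub, enorm_mul, ← ofReal_norm (modChar _ _), norm_modChar,
            ENNReal.ofReal_one, one_mul, sub_add_sub_cancel]
    _ = (∫⁻ τ in Icc 0 (t - s), N τ) + ∫⁻ τ in Icc 0 s, M τ := by
        rw [setLIntegral_Icc_sub_left N, setLIntegral_Icc_sub_left M]
        simp
    _ ≤ ENNReal.ofReal (t - s) ^ (2 * γ) * normSqK γ T f := by
        rw [normSqK, mul_add]
        refine add_le_add ?_ ?_
        · rw [le_ofReal_rpow_mul (a := 2 * γ) hδ (∫⁻ τ in Icc 0 (t - s), N τ)]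
          gcongr
          exact le_iSup₂_of_le (t - s) ⟨hδ.le, by linarith⟩ le_rfl
        · rw [le_ofReal_rpow_mul (a := 2 * γ) hδ (∫⁻ τ in Icc 0 s, M τ)]
          gcongr
          exact le_iSup₂_of_le t ⟨hs.trans hst.le, htT⟩
            (le_iSup₂_of_le s ⟨hs, hst.le⟩ le_rfl)

end freqField

/-! ### Dyadic chaining in the plane -/

/-- The dyadic point `2⁻ⁿ p`. -/
def gridPt (n : ℕ) (p : ℤ × ℤ) : ℝ × ℝ := (p.1 / 2 ^ n, p.2 / 2 ^ n)

/-- The index of the lower left corner of the dyadic cell of `z`. -/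
def floorPt (n : ℕ) (z : ℝ × ℝ) : ℤ × ℤ := (⌊2 ^ n * z.1⌋, ⌊2 ^ n * z.2⌋)

/-- Indices of the dyadic points in `[-N, N]²`. -/
def gridBox (N n : ℕ) : Finset (ℤ × ℤ) :=
  Finset.Icc (-(N * 2 ^ n : ℤ)) (N * 2 ^ n) ×ˢ Finset.Icc (-(N * 2 ^ n : ℤ)) (N * 2 ^ n)

/-- The steps between neighbouring grid points. -/
def gridSteps : Finset (ℤ × ℤ) := Finset.Icc (-1) 1 ×ˢ Finset.Icc (-1) 1

/-- The largest increment between neighbouring points of level `n` in `[-N, N]²`. -/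
def gridOsc (φ : ℝ × ℝ → ℂ) (N n : ℕ) : ℝ≥0∞ :=
  (gridBox N n ×ˢ gridSteps).sup fun a => edist (φ (gridPt n (a.1 + a.2))) (φ (gridPt n a.1))

lemma edist_le_gridOsc (φ : ℝ × ℝ → ℂ) {N n : ℕ} {p a : ℤ × ℤ} (hp : p ∈ gridBox N n)
    (ha : a ∈ gridSteps) : edist (φ (gridPt n (p + a))) (φ (gridPt n p)) ≤ gridOsc φ N n :=
  Finset.le_sup (f := fun a : (ℤ × ℤ) × (ℤ × ℤ) =>
    edist (φ (gridPt n (a.1 + a.2))) (φ (gridPt n a.1))) (b := (p, a))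
    (Finset.mem_product.2 ⟨hp, ha⟩)

lemma floorPt_mem_gridBox {N : ℕ} (n : ℕ) {z : ℝ × ℝ} (h1 : |z.1| ≤ N) (h2 : |z.2| ≤ N) :
    floorPt n z ∈ gridBox N n := by
  have key (x : ℝ) (hx : |x| ≤ N) : ⌊2 ^ n * x⌋ ∈ Finset.Icc (-(N * 2 ^ n : ℤ)) (N * 2 ^ n) := by
    have h2 : (0 : ℝ) < 2 ^ n := by positivity
    obtain ⟨ha, hb⟩ := abs_le.1 hx
    rw [Finset.mem_Icc]
    constructor
    · rw [Int.le_floor]; push_cast; nlinarith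
    · have : (⌊2 ^ n * x⌋ : ℝ) ≤ ((N * 2 ^ n : ℤ) : ℝ) :=
        (Int.floor_le _).trans (by push_cast; nlinarith)
      exact_mod_cast this
  exact Finset.mem_product.2 ⟨key _ h1, key _ h2⟩

/-- The level `n` corner is also a level `n + 1` grid point, and `2⌊u⌋ - ⌊2u⌋` is `0` or `-1`; so
consecutive corners of `z` are equal or neighbours on the finer grid. -/
lemma exists_floorPt_succ (n : ℕ) (z : ℝ × ℝ) :
    ∃ a ∈ gridSteps, gridPt n (floorPt n z) = gridPt (n + 1) (floorPt (n + 1) z + a) := by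
  have key (x : ℝ) : 2 * ⌊2 ^ n * x⌋ - ⌊2 ^ (n + 1) * x⌋ ∈ Finset.Icc (-1 : ℤ) 1 := by
    have h1 := Int.floor_le (2 ^ n * x)
    have h2 := Int.lt_floor_add_one (2 ^ n * x)
    have h3 := Int.floor_le (2 ^ (n + 1) * x)
    have h4 := Int.lt_floor_add_one (2 ^ (n + 1) * x)
    rw [pow_succ] at h3 h4
    have h5 : ((2 * ⌊2 ^ n * x⌋ : ℤ) : ℝ) < ((⌊2 ^ (n + 1) * x⌋ + 1 : ℤ) : ℝ) := by
      rw [pow_succ]; push_cast; nlinarith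
    have h6 : ((⌊2 ^ (n + 1) * x⌋ : ℤ) : ℝ) < ((2 * ⌊2 ^ n * x⌋ + 2 : ℤ) : ℝ) := by
      rw [pow_succ]; push_cast; nlinarith
    have h5' := Int.cast_lt.1 h5
    have h6' := Int.cast_lt.1 h6
    rw [Finset.mem_Icc]
    omega
  refine ⟨(2 * ⌊2 ^ n * z.1⌋ - ⌊2 ^ (n + 1) * z.1⌋, 2 * ⌊2 ^ n * z.2⌋ - ⌊2 ^ (n + 1) * z.2⌋),
    Finset.mem_product.2 ⟨key _, key _⟩, ?_⟩
  have h2 : (2 : ℝ) ^ n ≠ 0 := by positivity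
  simp only [gridPt, floorPt, Prod.mk_add_mk, add_sub_cancel, pow_succ]
  push_cast
  congr 1 <;> field_simp

lemma exists_floorPt_eq_add (n : ℕ) {z w : ℝ × ℝ} (h1 : |w.1 - z.1| ≤ (2 ^ n)⁻¹)
    (h2 : |w.2 - z.2| ≤ (2 ^ n)⁻¹) : ∃ a ∈ gridSteps, floorPt n w = floorPt n z + a := by
  have key (x y : ℝ) (h : |y - x| ≤ (2 ^ n)⁻¹) :
      ⌊2 ^ n * y⌋ - ⌊2 ^ n * x⌋ ∈ Finset.Icc (-1 : ℤ) 1 := by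
    have hp : (0 : ℝ) < 2 ^ n := by positivity
    have h' : |2 ^ n * y - 2 ^ n * x| ≤ 1 := by
      rw [← mul_sub, abs_mul, abs_of_pos hp]
      calc 2 ^ n * |y - x| ≤ 2 ^ n * (2 ^ n)⁻¹ := by gcongr
        _ = 1 := mul_inv_cancel₀ hp.ne'
    obtain ⟨ha, hb⟩ := abs_le.1 h'
    have h1 := Int.floor_le (2 ^ n * x)
    have h2 := Int.lt_floor_add_one (2 ^ n * x)
    have h3 := Int.floor_le (2 ^ n * y)
    have h4 := Int.lt_floor_add_one (2 ^ n * y)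
    have h5 : ((⌊2 ^ n * y⌋ : ℤ) : ℝ) < ((⌊2 ^ n * x⌋ + 2 : ℤ) : ℝ) := by push_cast; linarith
    have h6 : ((⌊2 ^ n * x⌋ : ℤ) : ℝ) < ((⌊2 ^ n * y⌋ + 2 : ℤ) : ℝ) := by push_cast; linarith
    have h5' := Int.cast_lt.1 h5
    have h6' := Int.cast_lt.1 h6
    rw [Finset.mem_Icc]
    omega
  refine ⟨(⌊2 ^ n * w.1⌋ - ⌊2 ^ n * z.1⌋, ⌊2 ^ n * w.2⌋ - ⌊2 ^ n * z.2⌋),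
    Finset.mem_product.2 ⟨key _ _ h1, key _ _ h2⟩, ?_⟩
  simp [floorPt]

lemma edist_gridPt_floorPt_le (n : ℕ) (z : ℝ × ℝ) :
    edist (gridPt n (floorPt n z)) z ≤ ENNReal.ofReal (2 ^ n)⁻¹ := by
  have hp : (0 : ℝ) < 2 ^ n := by positivity
  have key (x : ℝ) : edist ((⌊2 ^ n * x⌋ : ℝ) / 2 ^ n) x ≤ ENNReal.ofReal (2 ^ n)⁻¹ := by
    rw [edist_dist, Real.dist_eq]
    refine ENNReal.ofReal_le_ofReal ?_
    have h1 := Int.floor_le (2 ^ n * x)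
    have h2 := Int.lt_floor_add_one (2 ^ n * x)
    have e : (⌊2 ^ n * x⌋ : ℝ) / 2 ^ n - x = (⌊2 ^ n * x⌋ - 2 ^ n * x) * (2 ^ n)⁻¹ := by
      field_simp
    rw [e, abs_mul, abs_of_pos (inv_pos.2 hp)]
    refine mul_le_of_le_one_left (inv_pos.2 hp).le ?_
    rw [abs_le]
    constructor <;> linarith
  exact max_le (key _) (key _)

lemma tendsto_ofReal_two_pow_inv :
    Tendsto (fun n : ℕ => ENNReal.ofReal (2 ^ n)⁻¹) atTop (𝓝 0) := by
  have h : Tendsto (fun n : ℕ => ((2 : ℝ) ^ n)⁻¹) atTop (𝓝 0) :=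
    tendsto_inv_atTop_zero.comp (tendsto_pow_atTop_atTop_of_one_lt one_lt_two)
  simpa using ENNReal.tendsto_ofReal h

lemma tendsto_gridPt_floorPt (z : ℝ × ℝ) :
    Tendsto (fun n => gridPt n (floorPt n z)) atTop (𝓝 z) := by
  rw [tendsto_iff_edist_tendsto_0]
  exact tendsto_of_tendsto_of_tendsto_of_le_of_le tendsto_const_nhds tendsto_ofReal_two_pow_inv
    (fun _ => zero_le) (fun n => edist_gridPt_floorPt_le n z)

section deterministic

variable {φ : ℝ × ℝ → ℂ} {N : ℕ} {z w : ℝ × ℝ}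

lemma edist_floorPt_succ_le (n : ℕ) (h1 : |z.1| ≤ N) (h2 : |z.2| ≤ N) :
    edist (φ (gridPt n (floorPt n z))) (φ (gridPt (n + 1) (floorPt (n + 1) z))) ≤
      gridOsc φ N (n + 1) := by
  obtain ⟨a, ha, h⟩ := exists_floorPt_succ n z
  rw [h]
  exact edist_le_gridOsc φ (floorPt_mem_gridBox _ h1 h2) ha

lemma edist_floorPt_le_tsum {l : ℂ} (n : ℕ) (h1 : |z.1| ≤ N) (h2 : |z.2| ≤ N)
    (hl : Tendsto (fun n => φ (gridPt n (floorPt n z))) atTop (𝓝 l)) :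
    edist (φ (gridPt n (floorPt n z))) l ≤ ∑' m, gridOsc φ N (n + m + 1) :=
  edist_le_tsum_of_edist_le_of_tendsto (fun n => gridOsc φ N (n + 1))
    (fun n => edist_floorPt_succ_le n h1 h2) hl n

/-- Chain from `z` through its dyadic corners down to level `0`; the finitely many integer points
are compared with the origin directly. -/
lemma edist_le_of_continuous (hφ : Continuous φ) (h1 : |z.1| ≤ N) (h2 : |z.2| ≤ N) :
    edist (φ z) (φ 0) ≤ (∑' n, gridOsc φ N n) +
      (gridBox N 0).sup fun p => edist (φ (gridPt 0 p)) (φ 0) := by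
  have h := edist_floorPt_le_tsum 0 h1 h2 ((hφ.tendsto z).comp (tendsto_gridPt_floorPt z))
  refine (edist_triangle _ (φ (gridPt 0 (floorPt 0 z))) _).trans (add_le_add ?_ ?_)
  · rw [edist_comm]
    refine h.trans ?_
    simp only [zero_add]
    exact ENNReal.tsum_comp_le_tsum_of_injective (add_left_injective 1) (gridOsc φ N)
  · exact Finset.le_sup (f := fun p => edist (φ (gridPt 0 p)) (φ 0))
      (floorPt_mem_gridBox 0 h1 h2)

/-- The limit of a function along dyadic points. -/
def dyadicLim (φ : ℝ × ℝ → ℂ) (z : ℝ × ℝ) : ℂ :=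
  limUnder atTop fun n => φ (gridPt n (floorPt n z))

lemma tendsto_dyadicLim (hD : ∑' n, gridOsc φ N n ≠ ∞) (h1 : |z.1| ≤ N) (h2 : |z.2| ≤ N) :
    Tendsto (fun n => φ (gridPt n (floorPt n z))) atTop (𝓝 (dyadicLim φ z)) := by
  refine CauchySeq.tendsto_limUnder ?_
  refine cauchySeq_of_edist_le_of_tsum_ne_top (fun n => gridOsc φ N (n + 1))
    (fun n => edist_floorPt_succ_le n h1 h2) ?_
  exact ne_top_of_le_ne_top hD
    (ENNReal.tsum_comp_le_tsum_of_injective (add_left_injective 1) (gridOsc φ N))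

/-- Points within `2⁻ⁿ` have equal or neighbouring corners at level `n`, so their limits differ by
one grid step plus two tails of the convergent series. -/
lemma continuous_dyadicLim (hD : ∀ N, ∑' n, gridOsc φ N n ≠ ∞) : Continuous (dyadicLim φ) := by
  rw [continuous_iff_continuousAt]
  intro z
  -- The extra `1` keeps all points within `2⁻ⁿ ≤ 1` of `z` inside the same box.
  obtain ⟨N, hN⟩ := exists_nat_ge (max |z.1| |z.2| + 1)
  have hz1 : |z.1| ≤ N := by linarith [le_max_left |z.1| |z.2|]
  have hz2 : |z.2| ≤ N := by linarith [le_max_right |z.1| |z.2|]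
  have hbound (n : ℕ) (w : ℝ × ℝ) (h1 : |w.1 - z.1| ≤ (2 ^ n)⁻¹) (h2 : |w.2 - z.2| ≤ (2 ^ n)⁻¹) :
      edist (dyadicLim φ w) (dyadicLim φ z) ≤ 2 * ∑' m, gridOsc φ N (m + n) := by
    have hle : ((2 : ℝ) ^ n)⁻¹ ≤ 1 := inv_le_one_of_one_le₀ (one_le_pow₀ one_le_two)
    have hw1 : |w.1| ≤ N := by
      have := abs_sub_abs_le_abs_sub w.1 z.1
      linarith [le_max_left |z.1| |z.2|]
    have hw2 : |w.2| ≤ N := by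
      have := abs_sub_abs_le_abs_sub w.2 z.2
      linarith [le_max_right |z.1| |z.2|]
    have hz := edist_floorPt_le_tsum n hz1 hz2 (tendsto_dyadicLim (hD N) hz1 hz2)
    have hw := edist_floorPt_le_tsum n hw1 hw2 (tendsto_dyadicLim (hD N) hw1 hw2)
    obtain ⟨a, ha, h⟩ := exists_floorPt_eq_add n h1 h2
    have hzw : edist (φ (gridPt n (floorPt n w))) (φ (gridPt n (floorPt n z))) ≤ gridOsc φ N n := by
      rw [h]
      exact edist_le_gridOsc φ (floorPt_mem_gridBox _ hz1 hz2) ha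
    set t := ∑' m, gridOsc φ N (n + m + 1)
    have ht : ∑' m, gridOsc φ N (m + n) = gridOsc φ N n + t := by
      rw [tsum_eq_zero_add' ENNReal.summable, zero_add]
      congr 1
      exact tsum_congr fun m => by congr 1; omega
    calc edist (dyadicLim φ w) (dyadicLim φ z) ≤ t + gridOsc φ N n + t := by
          refine (edist_triangle4 _ (φ (gridPt n (floorPt n w))) (φ (gridPt n (floorPt n z))) _).trans ?_
          gcongr
          rwa [edist_comm]
      _ ≤ t + gridOsc φ N n + (t + gridOsc φ N n) := by gcongr; exact le_self_add
      _ = 2 * ∑' m, gridOsc φ N (m + n) := by rw [ht]; ring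
  have hlim : Tendsto (fun n => 2 * ∑' m, gridOsc φ N (m + n)) atTop (𝓝 0) := by
    have := ENNReal.Tendsto.const_mul (a := 2) (ENNReal.tendsto_sum_nat_add _ (hD N))
      (.inr ENNReal.ofNat_ne_top)
    simpa using this
  rw [EMetric.continuousAt_iff]
  intro ε hε
  obtain ⟨n, hn⟩ := ((tendsto_order.1 hlim).2 ε hε).exists
  refine ⟨ENNReal.ofReal (2 ^ n)⁻¹, by positivity, fun {w} hw => ?_⟩
  rw [edist_dist, ENNReal.ofReal_lt_ofReal_iff (by positivity), Prod.dist_eq, max_lt_iff,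
    Real.dist_eq, Real.dist_eq] at hw
  exact (hbound n w hw.1.le hw.2.le).trans_lt hn

end deterministic

/-! ### The Kolmogorov continuity criterion in the plane -/

section Kolmogorov

/-- A geometric bound on the `q`-th moments of the terms bounds the `q`-th moment of the sum. -/
lemma exists_lintegral_tsum_rpow_le {q : ℝ} (hq : 0 < q) {ρ : ℝ≥0} (hρ0 : 0 < ρ) (hρ : ρ < 1) :
    ∃ C : ℝ≥0, ∀ {Ω : Type*} [MeasurableSpace Ω] (P : Measure Ω) (u : ℕ → Ω → ℝ≥0∞) (K : ℝ≥0∞),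
      (∀ n, AEMeasurable (u n) P) → (∀ n, ∫⁻ ω, u n ω ^ q ∂P ≤ K * ρ ^ n) →
        ∫⁻ ω, (∑' n, u n ω) ^ q ∂P ≤ C * K := by
  -- Half of the decay `ρ = σ²` sums the terms pointwise, through the weights `r ^ n` with `r ^ q =
  -- σ`; the other half sums their moments. This covers all `q > 0`, without Minkowski.
  set σ : ℝ≥0 := ρ ^ (2⁻¹ : ℝ) with hσ
  set r : ℝ≥0 := σ ^ q⁻¹ with hr
  have hσ0 : 0 < σ := NNReal.rpow_pos hρ0
  have hr0 : 0 < r := NNReal.rpow_pos hσ0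
  have hσ1 : σ < 1 := NNReal.rpow_lt_one hρ (by norm_num)
  have hr1 : r < 1 := NNReal.rpow_lt_one hσ1 (by positivity)
  have hrq : r ^ q = σ := by rw [hr, ← NNReal.rpow_mul, inv_mul_cancel₀ hq.ne', NNReal.rpow_one]
  have hσσ : σ * σ = ρ := by
    rw [hσ, ← NNReal.rpow_add hρ0.ne']; norm_num
  have geom (x : ℝ≥0) (hx : x < 1) : ∑' n : ℕ, (x : ℝ≥0∞) ^ n ≠ ∞ := by
    rw [ENNReal.tsum_geometric, Ne, ENNReal.inv_eq_top, tsub_eq_zero_iff_le, not_le]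
    exact_mod_cast hx
  set G : ℝ≥0∞ := ∑' n : ℕ, (r : ℝ≥0∞) ^ n with hG
  set H : ℝ≥0∞ := ∑' n : ℕ, (σ : ℝ≥0∞) ^ n with hH
  have hfin : G ^ q * H ≠ ∞ :=
    ENNReal.mul_ne_top (ENNReal.rpow_ne_top_of_nonneg hq.le (geom r hr1)) (geom σ hσ1)
  refine ⟨(G ^ q * H).toNNReal, fun {Ω} _ P u K hu hK => ?_⟩
  rw [ENNReal.coe_toNNReal hfin]
  have hinv (n : ℕ) : (r : ℝ≥0∞) ^ n * ((r⁻¹ : ℝ≥0) : ℝ≥0∞) ^ n = 1 := by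
    rw [← mul_pow, ← ENNReal.coe_mul, mul_inv_cancel₀ hr0.ne', ENNReal.coe_one, one_pow]
  have hpt (ω : Ω) : (∑' n, u n ω) ^ q ≤
      G ^ q * ∑' m, (((r⁻¹ : ℝ≥0) : ℝ≥0∞) ^ m * u m ω) ^ q := by
    set S := ∑' m, (((r⁻¹ : ℝ≥0) : ℝ≥0∞) ^ m * u m ω) ^ q
    have h1 (n : ℕ) : u n ω ≤ (r : ℝ≥0∞) ^ n * S ^ q⁻¹ := by
      have h2 : ((r⁻¹ : ℝ≥0) : ℝ≥0∞) ^ n * u n ω ≤ S ^ q⁻¹ := by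
        rw [ENNReal.le_rpow_inv_iff hq]
        exact ENNReal.le_tsum n
      calc u n ω = (r : ℝ≥0∞) ^ n * (((r⁻¹ : ℝ≥0) : ℝ≥0∞) ^ n * u n ω) := by
            rw [← mul_assoc, hinv, one_mul]
        _ ≤ _ := by gcongr
    calc (∑' n, u n ω) ^ q ≤ (G * S ^ q⁻¹) ^ q := by
          gcongr
          rw [hG, ← ENNReal.tsum_mul_right]
          exact ENNReal.tsum_le_tsum h1
      _ = G ^ q * S := by
          rw [ENNReal.mul_rpow_of_nonneg _ _ hq.le, ← ENNReal.rpow_mul, inv_mul_cancel₀ hq.ne',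
            ENNReal.rpow_one]
  have hGq : G ^ q ≠ ∞ := ENNReal.rpow_ne_top_of_nonneg hq.le (geom r hr1)
  calc ∫⁻ ω, (∑' n, u n ω) ^ q ∂P
      ≤ ∫⁻ ω, G ^ q * ∑' m, (((r⁻¹ : ℝ≥0) : ℝ≥0∞) ^ m * u m ω) ^ q ∂P := lintegral_mono hpt
    _ = G ^ q * ∑' m, ∫⁻ ω, (((r⁻¹ : ℝ≥0) : ℝ≥0∞) ^ m * u m ω) ^ q ∂P := by
        rw [lintegral_const_mul' _ _ hGq, lintegral_tsum]
        exact fun m => ((hu m).const_mul _).pow_const q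
    _ ≤ G ^ q * ∑' m, K * (σ : ℝ≥0∞) ^ m := by
        gcongr with m
        have hfin2 : (((r⁻¹ : ℝ≥0) : ℝ≥0∞) ^ m) ^ q ≠ ∞ :=
          ENNReal.rpow_ne_top_of_nonneg hq.le (ENNReal.pow_ne_top ENNReal.coe_ne_top)
        simp_rw [ENNReal.mul_rpow_of_nonneg _ _ hq.le]
        rw [lintegral_const_mul' _ _ hfin2]
        refine (mul_le_mul_right (hK m) _).trans (le_of_eq ?_)
        rw [mul_left_comm]
        congr 1
        have : (r⁻¹ ^ m) ^ q * ρ ^ m = σ ^ m := by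
          rw [← NNReal.rpow_natCast, ← NNReal.rpow_mul, mul_comm (m : ℝ), NNReal.rpow_mul,
            NNReal.rpow_natCast, NNReal.inv_rpow, hrq, ← mul_pow, ← hσσ,
            inv_mul_cancel_left₀ hσ0.ne']
        rw [← ENNReal.coe_pow, ← ENNReal.coe_rpow_of_nonneg _ hq.le, ← ENNReal.coe_pow,
          ← ENNReal.coe_pow, ← ENNReal.coe_mul, this]
    _ = G ^ q * H * K := by rw [ENNReal.tsum_mul_left]; ring

end Kolmogorov

/-! ### Moments of the grid oscillations -/

section Kolmogorov

lemma card_gridBox_mul_le (N n : ℕ) :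
    ((gridBox N n ×ˢ gridSteps).card : ℝ≥0∞) ≤ 9 * (2 * N + 1) ^ 2 * 4 ^ n := by
  have h1 : (gridBox N n ×ˢ gridSteps).card = (2 * (N * 2 ^ n) + 1) ^ 2 * 9 := by
    rw [Finset.card_product, gridBox, gridSteps, Finset.card_product, Finset.card_product,
      Int.card_Icc, Int.card_Icc]
    have : ((N * 2 ^ n : ℤ) + 1 - -(N * 2 ^ n)).toNat = 2 * (N * 2 ^ n) + 1 := by
      have : (N * 2 ^ n : ℤ) = ((N * 2 ^ n : ℕ) : ℤ) := by push_cast; ring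
      rw [this]; omega
    rw [this]
    norm_num [sq]
    rfl
  rw [h1]
  have h2 : (2 * (N * 2 ^ n) + 1) ^ 2 * 9 ≤ 9 * (2 * N + 1) ^ 2 * 4 ^ n := by
    have h3 : 2 * (N * 2 ^ n) + 1 ≤ (2 * N + 1) * 2 ^ n := by
      have := Nat.one_le_two_pow (n := n)
      nlinarith
    calc (2 * (N * 2 ^ n) + 1) ^ 2 * 9 ≤ ((2 * N + 1) * 2 ^ n) ^ 2 * 9 := by gcongr
      _ = 9 * (2 * N + 1) ^ 2 * 4 ^ n := by
        rw [mul_pow, ← pow_mul, mul_comm n 2, pow_mul]; norm_num; ring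
  exact_mod_cast h2

lemma finset_sup_rpow_le_sum {ι : Type*} (s : Finset ι) (u : ι → ℝ≥0∞) {q : ℝ} (hq : 0 < q) :
    s.sup u ^ q ≤ ∑ i ∈ s, u i ^ q := by
  rw [← ENNReal.le_rpow_inv_iff hq]
  refine Finset.sup_le fun i hi => ?_
  rw [ENNReal.le_rpow_inv_iff hq]
  exact Finset.single_le_sum (f := fun i => u i ^ q) (fun _ _ => zero_le) hi

lemma aemeasurable_finset_sup {α ι : Type*} [MeasurableSpace α] {μ : Measure α} (s : Finset ι)
    {u : ι → α → ℝ≥0∞} (hu : ∀ i, AEMeasurable (u i) μ) :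
    AEMeasurable (fun x => s.sup fun i => u i x) μ := by
  classical
  induction s using Finset.induction_on with
  | empty => simp
  | insert a s _ ih =>
    simp only [Finset.sup_insert]
    exact (hu a).sup ih

variable {Ω : Type*} [MeasurableSpace Ω] {P : Measure Ω} {X : ℝ × ℝ → Ω → ℂ} {q γ : ℝ} {A : ℝ≥0∞}

lemma edist_gridPt_add_le (n : ℕ) (p : ℤ × ℤ) {a : ℤ × ℤ} (ha : a ∈ gridSteps) :
    edist (gridPt n (p + a)) (gridPt n p) ≤ (((2⁻¹ : ℝ≥0) ^ n : ℝ≥0) : ℝ≥0∞) := by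
  have hp : (0 : ℝ) < 2 ^ n := by positivity
  have key (i j : ℤ) (hj : j ∈ Finset.Icc (-1 : ℤ) 1) :
      edist (((i + j : ℤ) : ℝ) / 2 ^ n) ((i : ℝ) / 2 ^ n) ≤ (((2⁻¹ : ℝ≥0) ^ n : ℝ≥0) : ℝ≥0∞) := by
    rw [edist_dist, Real.dist_eq, ← sub_div, abs_div, abs_of_pos hp, ← ENNReal.ofReal_coe_nnreal]
    refine ENNReal.ofReal_le_ofReal ?_
    push_cast
    rw [add_sub_cancel_left, inv_pow, div_eq_mul_inv]
    refine mul_le_of_le_one_left (inv_pos.2 hp).le ?_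
    rw [Finset.mem_Icc] at hj
    rw [abs_le]
    exact ⟨by exact_mod_cast hj.1, by exact_mod_cast hj.2⟩
  obtain ⟨h1, h2⟩ := Finset.mem_product.1 ha
  exact max_le (key _ _ h1) (key _ _ h2)

lemma aemeasurable_gridOsc (hX : ∀ z, AEMeasurable (X z) P) (N n : ℕ) :
    AEMeasurable (fun ω => gridOsc (X · ω) N n) P :=
  aemeasurable_finset_sup _ fun _ => (hX _).edist (hX _)

/-- Bound the maximum by the sum: about `4 ^ n` pairs, each contributing `(A 2^{-nγ})^q`. The ratio
`4 · 2^{-γq}` is less than one exactly when `γ q > 2`. -/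
lemma lintegral_gridOsc_rpow_le (hq : 0 < q) (hγ : 0 < γ) (hX : ∀ z, AEMeasurable (X z) P)
    (h : ∀ z w, ∫⁻ ω, edist (X z ω) (X w ω) ^ q ∂P ≤ (A * edist z w ^ γ) ^ q) (N n : ℕ) :
    ∫⁻ ω, gridOsc (X · ω) N n ^ q ∂P ≤
      9 * (2 * N + 1) ^ 2 * A ^ q * ((4 * 2⁻¹ ^ (γ * q) : ℝ≥0) : ℝ≥0∞) ^ n := by
  calc ∫⁻ ω, gridOsc (X · ω) N n ^ q ∂P
      ≤ ∫⁻ ω, ∑ a ∈ gridBox N n ×ˢ gridSteps,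
          edist (X (gridPt n (a.1 + a.2)) ω) (X (gridPt n a.1) ω) ^ q ∂P :=
        lintegral_mono fun ω => finset_sup_rpow_le_sum _ _ hq
    _ = ∑ a ∈ gridBox N n ×ˢ gridSteps,
          ∫⁻ ω, edist (X (gridPt n (a.1 + a.2)) ω) (X (gridPt n a.1) ω) ^ q ∂P :=
        lintegral_finsetSum' _ fun a _ => ((hX _).edist (hX _)).pow_const q
    _ ≤ ∑ a ∈ gridBox N n ×ˢ gridSteps, (A * (((2⁻¹ : ℝ≥0) ^ n : ℝ≥0) : ℝ≥0∞) ^ γ) ^ q := by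
        refine Finset.sum_le_sum fun a ha => (h _ _).trans ?_
        gcongr
        exact edist_gridPt_add_le n _ (Finset.mem_product.1 ha).2
    _ ≤ 9 * (2 * N + 1) ^ 2 * 4 ^ n * (A * (((2⁻¹ : ℝ≥0) ^ n : ℝ≥0) : ℝ≥0∞) ^ γ) ^ q := by
        rw [Finset.sum_const, nsmul_eq_mul]
        gcongr
        exact card_gridBox_mul_le N n
    _ = 9 * (2 * N + 1) ^ 2 * A ^ q * ((4 * 2⁻¹ ^ (γ * q) : ℝ≥0) : ℝ≥0∞) ^ n := by
        rw [ENNReal.mul_rpow_of_nonneg _ _ hq.le, ← ENNReal.rpow_mul,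
          ← ENNReal.coe_rpow_of_nonneg _ (by positivity), ← NNReal.rpow_natCast,
          ← NNReal.rpow_mul, mul_comm (n : ℝ), NNReal.rpow_mul, NNReal.rpow_natCast]
        push_cast
        rw [mul_pow]
        ring

lemma four_mul_two_inv_rpow_lt_one {s : ℝ} (hs : 2 < s) : (4 * 2⁻¹ ^ s : ℝ≥0) < 1 := by
  have h : (2⁻¹ : ℝ≥0) ^ s < 2⁻¹ ^ (2 : ℝ) :=
    NNReal.rpow_lt_rpow_of_exponent_gt (by norm_num) (by rw [← NNReal.coe_lt_coe]; norm_num) hs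
  calc (4 * 2⁻¹ ^ s : ℝ≥0) < 4 * 2⁻¹ ^ (2 : ℝ) := by gcongr
    _ = 1 := by
      rw [show (2 : ℝ) = ((2 : ℕ) : ℝ) by norm_num, NNReal.rpow_natCast, ← NNReal.coe_inj]
      norm_num

/-- Kolmogorov's criterion, quantitative part: a moment bound for the supremum of the increments of
a continuous process over `[-N, N]²`. -/
theorem exists_kolmogorov_bound (hq : 0 < q) (hγ : 0 < γ) (hγq : 2 < γ * q) (N : ℕ) :
    ∃ C : ℝ≥0, ∀ {Ω : Type*} [MeasurableSpace Ω] (P : Measure Ω) (X : ℝ × ℝ → Ω → ℂ) (A : ℝ≥0∞),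
      (∀ z, AEMeasurable (X z) P) →
      (∀ z w, ∫⁻ ω, edist (X z ω) (X w ω) ^ q ∂P ≤ (A * edist z w ^ γ) ^ q) →
      ∃ S : Ω → ℝ≥0∞, AEMeasurable S P ∧ ∫⁻ ω, S ω ^ q ∂P ≤ C * A ^ q ∧
        ∀ ω, Continuous (X · ω) → ∀ z : ℝ × ℝ, |z.1| ≤ N → |z.2| ≤ N →
          edist (X z ω) (X 0 ω) ≤ S ω := by
  obtain ⟨C, hC⟩ := exists_lintegral_tsum_rpow_le hq (ρ := 4 * 2⁻¹ ^ (γ * q)) (by positivity)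
    (four_mul_two_inv_rpow_lt_one hγq)
  have hNtop : ((N : ℝ≥0∞) ^ γ) ^ q ≠ ∞ := ENNReal.rpow_ne_top_of_nonneg hq.le
    (ENNReal.rpow_ne_top_of_nonneg hγ.le (ENNReal.natCast_ne_top N))
  refine ⟨2 ^ q * (C * (9 * (2 * N + 1) ^ 2) + (gridBox N 0).card * (((N : ℝ≥0) ^ γ) ^ q)),
    fun {Ω} _ P X A hX h => ?_⟩
  have hD := hC P (fun n ω => gridOsc (X · ω) N n) _ (fun n => aemeasurable_gridOsc hX N n)
    (fun n => lintegral_gridOsc_rpow_le hq hγ hX h N n)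
  -- `D` collects the chaining increments, `B` the increments from the origin to the integer points,
  -- which lie within sup-distance `N` of it.
  let D : Ω → ℝ≥0∞ := fun ω => ∑' n, gridOsc (X · ω) N n
  let B : Ω → ℝ≥0∞ := fun ω => (gridBox N 0).sup fun p => edist (X (gridPt 0 p) ω) (X 0 ω)
  have hDm : AEMeasurable D P := AEMeasurable.tsum fun n => aemeasurable_gridOsc hX N n
  have hBm : AEMeasurable B P := aemeasurable_finset_sup _ fun _ => (hX _).edist (hX _)
  have hB : ∫⁻ ω, B ω ^ q ∂P ≤ (gridBox N 0).card * (((N : ℝ≥0∞) ^ γ) ^ q) * A ^ q := by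
    calc ∫⁻ ω, B ω ^ q ∂P
        ≤ ∫⁻ ω, ∑ p ∈ gridBox N 0, edist (X (gridPt 0 p) ω) (X 0 ω) ^ q ∂P :=
          lintegral_mono fun ω => finset_sup_rpow_le_sum _ _ hq
      _ = ∑ p ∈ gridBox N 0, ∫⁻ ω, edist (X (gridPt 0 p) ω) (X 0 ω) ^ q ∂P :=
          lintegral_finsetSum' _ fun a _ => ((hX _).edist (hX _)).pow_const q
      _ ≤ ∑ p ∈ gridBox N 0, (A * (N : ℝ≥0∞) ^ γ) ^ q := by
          refine Finset.sum_le_sum fun p hp => (h _ _).trans ?_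
          have key (i : ℤ) (hi : i ∈ Finset.Icc (-(N * 2 ^ 0 : ℤ)) (N * 2 ^ 0)) :
              edist ((i : ℝ) / 2 ^ 0) 0 ≤ N := by
            rw [Finset.mem_Icc] at hi
            rw [edist_dist, Real.dist_eq, ← ENNReal.ofReal_natCast]
            refine ENNReal.ofReal_le_ofReal ?_
            rw [pow_zero, div_one, sub_zero, abs_le]
            simp only [pow_zero, mul_one] at hi
            exact ⟨by exact_mod_cast hi.1, by exact_mod_cast hi.2⟩
          obtain ⟨h1, h2⟩ := Finset.mem_product.1 hp
          gcongr
          exact max_le (key _ h1) (key _ h2)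
      _ = (gridBox N 0).card * (((N : ℝ≥0∞) ^ γ) ^ q) * A ^ q := by
          rw [Finset.sum_const, nsmul_eq_mul, ENNReal.mul_rpow_of_nonneg _ _ hq.le]
          ring
  refine ⟨fun ω => D ω + B ω, hDm.add hBm, ?_, fun ω hω z h1 h2 =>
    edist_le_of_continuous hω h1 h2⟩
  have hpt (a b : ℝ≥0∞) : (a + b) ^ q ≤ 2 ^ q * (a ^ q + b ^ q) := by
    have h1 : a + b ≤ 2 * max a b := by
      rw [two_mul]; exact add_le_add (le_max_left _ _) (le_max_right _ _)
    calc (a + b) ^ q ≤ (2 * max a b) ^ q := by gcongr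
      _ = 2 ^ q * max a b ^ q := ENNReal.mul_rpow_of_nonneg _ _ hq.le
      _ ≤ 2 ^ q * (a ^ q + b ^ q) := by
        gcongr
        rcases le_total a b with h | h
        · rw [max_eq_right h]; exact le_add_self
        · rw [max_eq_left h]; exact le_self_add
  calc ∫⁻ ω, (D ω + B ω) ^ q ∂P ≤ ∫⁻ ω, 2 ^ q * (D ω ^ q + B ω ^ q) ∂P :=
        lintegral_mono fun ω => hpt _ _
    _ = 2 ^ q * (∫⁻ ω, D ω ^ q ∂P + ∫⁻ ω, B ω ^ q ∂P) := by
        rw [lintegral_const_mul' _ _ (ENNReal.rpow_ne_top_of_nonneg hq.le ENNReal.ofNat_ne_top),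
          lintegral_add_left' (hDm.pow_const q)]
    _ ≤ 2 ^ q * (C * (9 * (2 * N + 1) ^ 2 * A ^ q) +
          (gridBox N 0).card * (((N : ℝ≥0∞) ^ γ) ^ q) * A ^ q) := by gcongr
    _ = _ := by
        push_cast
        rw [ENNReal.coe_rpow_of_nonneg _ hq.le, ENNReal.coe_rpow_of_nonneg _ hq.le,
          ENNReal.coe_rpow_of_nonneg _ hγ.le]
        push_cast
        ring

/-- Kolmogorov's criterion, qualitative part: existence of a continuous modification. -/
theorem exists_continuous_modification (hq : 0 < q) (hγ : 0 < γ) (hγq : 2 < γ * q) (hA : A ≠ ∞)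
    (hX : ∀ z, AEMeasurable (X z) P)
    (h : ∀ z w, ∫⁻ ω, edist (X z ω) (X w ω) ^ q ∂P ≤ (A * edist z w ^ γ) ^ q) :
    ∃ Φ : ℝ × ℝ → Ω → ℂ, (∀ᵐ ω ∂P, Continuous (Φ · ω)) ∧ ∀ z, Φ z =ᵐ[P] X z := by
  obtain ⟨C, hC⟩ := exists_lintegral_tsum_rpow_le hq (ρ := 4 * 2⁻¹ ^ (γ * q)) (by positivity)
    (four_mul_two_inv_rpow_lt_one hγq)
  have hfin : ∀ᵐ ω ∂P, ∀ N, ∑' n, gridOsc (X · ω) N n ≠ ∞ := by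
    rw [ae_all_iff]
    intro N
    have hD := hC P (fun n ω => gridOsc (X · ω) N n) _ (fun n => aemeasurable_gridOsc hX N n)
      (fun n => lintegral_gridOsc_rpow_le hq hγ hX h N n)
    have hDm : AEMeasurable (fun ω => ∑' n, gridOsc (X · ω) N n) P :=
      AEMeasurable.tsum fun n => aemeasurable_gridOsc hX N n
    have hlt : ∫⁻ ω, (∑' n, gridOsc (X · ω) N n) ^ q ∂P ≠ ∞ := by
      refine ne_top_of_le_ne_top (ENNReal.mul_ne_top ENNReal.coe_ne_top
        (ENNReal.mul_ne_top ?_ (ENNReal.rpow_ne_top_of_nonneg hq.le hA))) hD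
      exact ENNReal.mul_ne_top (by simp) (ENNReal.pow_ne_top (by
        rw [ENNReal.add_ne_top]
        exact ⟨ENNReal.mul_ne_top (by simp) (by simp), by simp⟩))
    filter_upwards [ae_lt_top' (hDm.pow_const q) hlt] with ω hω hω'
    rw [hω', ENNReal.top_rpow_of_pos hq] at hω
    exact lt_irrefl _ hω
  refine ⟨fun z ω => dyadicLim (X · ω) z, ?_, fun z => ?_⟩
  · filter_upwards [hfin] with ω hω using continuous_dyadicLim hω
  · obtain ⟨N, hN⟩ := exists_nat_ge (max |z.1| |z.2|)
    have hlim : ∀ᵐ ω ∂P, Tendsto (fun n => edist (X (gridPt n (floorPt n z)) ω) (X z ω) ^ q) atTop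
        (𝓝 (edist (dyadicLim (X · ω) z) (X z ω) ^ q)) := by
      filter_upwards [hfin] with ω hω
      refine (ENNReal.continuous_rpow_const.tendsto _).comp ?_
      exact (tendsto_dyadicLim (hω N) ((le_max_left _ _).trans hN)
        ((le_max_right _ _).trans hN)).edist tendsto_const_nhds
    have hbound : Tendsto (fun n => (A * ENNReal.ofReal (2 ^ n)⁻¹ ^ γ) ^ q) atTop (𝓝 0) := by
      have h1 := (ENNReal.continuous_rpow_const (y := γ)).tendsto 0 |>.comp
        tendsto_ofReal_two_pow_inv
      rw [ENNReal.zero_rpow_of_pos hγ] at h1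
      have h2 := ENNReal.Tendsto.const_mul (a := A) h1 (.inr hA)
      rw [mul_zero] at h2
      have h3 := (ENNReal.continuous_rpow_const (y := q)).tendsto 0 |>.comp h2
      rwa [ENNReal.zero_rpow_of_pos hq] at h3
    -- The limit is a modification: by Fatou, its distance to `X z` has `q`-th moment at most the
    -- limit of the increment bounds along the dyadic points, which is zero.
    have hzero : ∫⁻ ω, edist (dyadicLim (X · ω) z) (X z ω) ^ q ∂P = 0 := by
      rw [← nonpos_iff_eq_zero]
      calc ∫⁻ ω, edist (dyadicLim (X · ω) z) (X z ω) ^ q ∂P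
          = ∫⁻ ω, liminf (fun n => edist (X (gridPt n (floorPt n z)) ω) (X z ω) ^ q) atTop ∂P :=
            lintegral_congr_ae (hlim.mono fun ω hω => hω.liminf_eq.symm)
        _ ≤ liminf (fun n => ∫⁻ ω, edist (X (gridPt n (floorPt n z)) ω) (X z ω) ^ q ∂P) atTop :=
            lintegral_liminf_le' fun n => ((hX _).edist (hX _)).pow_const q
        _ ≤ liminf (fun n => (A * ENNReal.ofReal (2 ^ n)⁻¹ ^ γ) ^ q) atTop := by
            refine liminf_le_liminf (Eventually.of_forall fun n => (h _ _).trans ?_)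
            gcongr
            exact edist_gridPt_floorPt_le n z
        _ = 0 := hbound.liminf_eq
    have hm : AEMeasurable (fun ω => edist (dyadicLim (X · ω) z) (X z ω) ^ q) P :=
      aemeasurable_of_tendsto_metrizable_ae atTop
        (fun n => ((hX (gridPt n (floorPt n z))).edist (hX z)).pow_const q) hlim
    filter_upwards [(lintegral_eq_zero_iff' hm).1 hzero] with ω hω
    rw [Pi.zero_apply, ENNReal.rpow_eq_zero_iff_of_pos hq, edist_eq_zero] at hω
    exact hω

end Kolmogorov

/-! ### Moments of the supremum over a box -/

section SupBound

lemma ENNReal.le_mul_rpow_half_of_sq_le {a c N : ℝ≥0∞} (h : a ^ 2 ≤ c ^ 2 * N) :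
    a ≤ c * N ^ (1 / 2 : ℝ) := by
  have e (b : ℝ≥0∞) : (b ^ 2) ^ (1 / 2 : ℝ) = b := by
    rw [← ENNReal.rpow_natCast, ← ENNReal.rpow_mul]
    norm_num
  rw [← e a, ← e c, ← ENNReal.mul_rpow_of_nonneg _ _ (by norm_num)]
  gcongr

variable {p q γ : ℝ}

lemma lintegral_edist_rpow_eq {Ω : Type*} [MeasurableSpace Ω] {P : Measure Ω} (hq : 0 < q)
    (Y Z : Ω → ℂ) :
    ∫⁻ ω, edist (Y ω) (Z ω) ^ q ∂P = eLpNorm (Y - Z) (ENNReal.ofReal q) P ^ q := by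
  rw [eLpNorm_eq_lintegral_rpow_enorm_toReal (by simpa using hq) ENNReal.ofReal_ne_top,
    ENNReal.toReal_ofReal hq.le, ← ENNReal.rpow_mul, one_div_mul_cancel hq.ne', ENNReal.rpow_one]
  simp_rw [Pi.sub_apply, edist_eq_enorm_sub]

lemma lintegral_rpow_le_lintegral_rpow {Ω : Type*} [MeasurableSpace Ω] {P : Measure Ω}
    [IsProbabilityMeasure P] (hp : 0 < p) (hpq : p ≤ q) {u : Ω → ℝ≥0∞} (hu : AEMeasurable u P) :
    ∫⁻ ω, u ω ^ p ∂P ≤ (∫⁻ ω, u ω ^ q ∂P) ^ (p / q) := by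
  have h := eLpNorm'_le_eLpNorm'_of_exponent_le (f := u) hp hpq P hu.aestronglyMeasurable
  simp only [eLpNorm', enorm_eq_self] at h
  have h2 := ENNReal.rpow_le_rpow h hp.le
  rwa [← ENNReal.rpow_mul, ← ENNReal.rpow_mul, one_div_mul_cancel hp.ne', ENNReal.rpow_one,
    one_div_mul_eq_div] at h2

/-- A random field on the plane whose increments have Hölder continuous moments has a moment bound
for its supremum over `[-N, N]²`. -/
theorem exists_lintegral_sup_rpow_le (hp : 1 < p) (hpq : p ≤ q) (hγ : 0 < γ) (hγq : 2 < γ * q)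
    (N : ℕ) (K : ℝ≥0) :
    ∃ C : ℝ≥0, 0 < C ∧ ∀ {Ω : Type*} [MeasurableSpace Ω] (P : Measure Ω) [IsProbabilityMeasure P]
      (X : ℝ × ℝ → Ω → ℂ) (B : ℝ≥0∞), (∀ z, AEStronglyMeasurable (X z) P) →
      (∀ᵐ ω ∂P, Continuous (X · ω)) → eLpNorm (X 0) (ENNReal.ofReal q) P ≤ K * B →
      (∀ z w, eLpNorm (X z - X w) (ENNReal.ofReal q) P ≤ K * B * edist z w ^ γ) →
      ∫⁻ ω, (⨆ z : ℝ × ℝ, ⨆ (_ : |z.1| ≤ N ∧ |z.2| ≤ N), ‖X z ω‖ₑ) ^ p ∂P ≤ C * B ^ p := by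
  have hq : 0 < q := by linarith
  have hp0 : 0 < p := by linarith
  obtain ⟨D, hD⟩ := exists_kolmogorov_bound hq hγ hγq N
  -- The summand `1` only ensures `0 < C`, so that the final bound is `∞` whenever the norm of `f`
  -- is.
  refine ⟨((K + (D * K ^ q) ^ (1 / q)) ^ p) + 1, by positivity,
    fun {Ω} _ P _ X B hX hcont h0 hinc => ?_⟩
  obtain ⟨S, hSm, hS, hbound⟩ := hD P X (K * B) (fun z => (hX z).aemeasurable) fun z w => by
    rw [lintegral_edist_rpow_eq hq]
    exact ENNReal.rpow_le_rpow (hinc z w) hq.le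
  have hM : AEMeasurable (fun ω => ‖X 0 ω‖ₑ) P := (hX 0).enorm
  have h1 : (∫⁻ ω, ‖X 0 ω‖ₑ ^ q ∂P) ^ (1 / q) ≤ K * B := by
    rwa [eLpNorm_eq_lintegral_rpow_enorm_toReal (by simpa using hq) ENNReal.ofReal_ne_top,
      ENNReal.toReal_ofReal hq.le] at h0
  have h2 : (∫⁻ ω, S ω ^ q ∂P) ^ (1 / q) ≤ ((D * K ^ q) ^ (1 / q) : ℝ≥0) * B := by
    refine (ENNReal.rpow_le_rpow hS (by positivity)).trans (le_of_eq ?_)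
    rw [ENNReal.mul_rpow_of_nonneg _ _ hq.le, ← mul_assoc,
      ENNReal.mul_rpow_of_nonneg _ _ (by positivity : 0 ≤ 1 / q), ← ENNReal.rpow_mul,
      mul_one_div_cancel hq.ne', ENNReal.rpow_one,
      ENNReal.coe_rpow_of_nonneg _ (by positivity : 0 ≤ 1 / q), ENNReal.coe_mul,
      ENNReal.coe_rpow_of_nonneg _ hq.le]
  calc ∫⁻ ω, (⨆ z : ℝ × ℝ, ⨆ (_ : |z.1| ≤ N ∧ |z.2| ≤ N), ‖X z ω‖ₑ) ^ p ∂P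
      ≤ ∫⁻ ω, (‖X 0 ω‖ₑ + S ω) ^ p ∂P := by
        refine lintegral_mono_ae ?_
        filter_upwards [hcont] with ω hω
        gcongr
        refine iSup₂_le fun z hz => ?_
        calc ‖X z ω‖ₑ = ‖X 0 ω + (X z ω - X 0 ω)‖ₑ := by rw [add_sub_cancel]
          _ ≤ ‖X 0 ω‖ₑ + ‖X z ω - X 0 ω‖ₑ := enorm_add_le _ _
          _ ≤ ‖X 0 ω‖ₑ + S ω := by
            gcongr
            rw [← edist_eq_enorm_sub]
            exact hbound ω hω z hz.1 hz.2
    _ ≤ (∫⁻ ω, (‖X 0 ω‖ₑ + S ω) ^ q ∂P) ^ (p / q) :=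
        lintegral_rpow_le_lintegral_rpow hp0 hpq (hM.add hSm)
    _ = ((∫⁻ ω, (‖X 0 ω‖ₑ + S ω) ^ q ∂P) ^ (1 / q)) ^ p := by
        rw [← ENNReal.rpow_mul, one_div_mul_eq_div]
    _ ≤ (K * B + ((D * K ^ q) ^ (1 / q) : ℝ≥0) * B) ^ p := by
        gcongr
        exact (ENNReal.lintegral_Lp_add_le hM hSm (by linarith)).trans (add_le_add h1 h2)
    _ = ((K + (D * K ^ q) ^ (1 / q)) ^ p : ℝ≥0) * B ^ p := by
        rw [← add_mul, ENNReal.mul_rpow_of_nonneg _ _ hp0.le, ENNReal.coe_rpow_of_nonneg _ hp0.le,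
          ENNReal.coe_add]
    _ ≤ _ := by
        gcongr
        exact le_self_add

end SupBound

/-! ### Hölder bounds for the frequency field with exponent `γ'` -/

section Increments

variable {γ γ' T : ℝ} {f : ℝ → ℝ → ℂ} {s t : ℝ}

lemma eLpNorm_freqField_le
    (hf : AEStronglyMeasurable (Function.uncurry f) ((volume.restrict (Icc 0 T)).prod volume))
    (htT : t ≤ T) (x : ℝ) :
    eLpNorm (freqField f t x) 2 (halfLine.prod volume) ≤ normSqL2H γ T f ^ (1 / 2 : ℝ) := by
  have := ENNReal.le_mul_rpow_half_of_sq_le (c := 1)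
    (by simpa using eLpNorm_freqField_sq_le hf htT x γ)
  simpa using this

lemma eLpNorm_freqField_sub_space_le
    (hf : AEStronglyMeasurable (Function.uncurry f) ((volume.restrict (Icc 0 T)).prod volume))
    (htT : t ≤ T) (hγ0 : 0 < γ') (hγ1 : γ' ≤ 1) (hγ : γ' ≤ γ) (x y : ℝ) :
    eLpNorm (freqField f t x - freqField f t y) 2 (halfLine.prod volume) ≤
      2 * edist x y ^ γ' * normSqL2H γ T f ^ (1 / 2 : ℝ) := by
  have h := ENNReal.le_mul_rpow_half_of_sq_le
    (eLpNorm_freqField_sub_space_sq_le hf htT hγ0 hγ1 hγ x y)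
  rwa [ENNReal.ofReal_mul (by norm_num), ← ENNReal.ofReal_rpow_of_nonneg (abs_nonneg _) hγ0.le,
    ← Real.dist_eq, ← edist_dist, ENNReal.ofReal_ofNat] at h

/-- `normSqK` provides the exponent `γ`; it is lowered to `γ'` by `|t - s|^{γ - γ'} ≤ T^{γ - γ'}`,
one source of the dependence on `T`. -/
lemma eLpNorm_freqField_sub_time_le
    (hf : AEStronglyMeasurable (Function.uncurry f) ((volume.restrict (Icc 0 T)).prod volume))
    (hs : s ∈ Icc 0 T) (ht : t ∈ Icc 0 T) (hγ : γ' ≤ γ) (x : ℝ) :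
    eLpNorm (freqField f t x - freqField f s x) 2 (halfLine.prod volume) ≤
      ENNReal.ofReal T ^ (γ - γ') * edist t s ^ γ' * normSqK γ T f ^ (1 / 2 : ℝ) := by
  wlog hst : s ≤ t generalizing s t
  · rw [eLpNorm_sub_comm, edist_comm]
    exact this ht hs (le_of_not_ge hst)
  rcases hst.eq_or_lt with rfl | hst
  · simp
  have h := eLpNorm_freqField_sub_time_sq_le hf hs.1 hst ht.2 x γ
  rw [mul_comm 2 γ, ENNReal.rpow_mul, ENNReal.rpow_two] at h
  refine (ENNReal.le_mul_rpow_half_of_sq_le h).trans ?_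
  gcongr
  have hδ : 0 < t - s := sub_pos.2 hst
  calc ENNReal.ofReal (t - s) ^ γ
      = ENNReal.ofReal (t - s) ^ (γ - γ') * ENNReal.ofReal (t - s) ^ γ' := by
        rw [← ENNReal.rpow_add _ _ (by simpa using hδ) ENNReal.ofReal_ne_top, sub_add_cancel]
    _ ≤ ENNReal.ofReal T ^ (γ - γ') * edist t s ^ γ' := by
        rw [edist_dist, Real.dist_eq, abs_of_pos hδ]
        gcongr
        linarith [hs.1, ht.2]

lemma edist_mul_left_rpow_le {L : ℝ} (hL : 0 ≤ L) (hγ0 : 0 ≤ γ') (z w : ℝ × ℝ) :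
    edist (L * z.2) (L * w.2) ^ γ' ≤ ENNReal.ofReal L ^ γ' * edist z w ^ γ' := by
  rw [← ENNReal.mul_rpow_of_nonneg _ _ hγ0]
  gcongr
  rw [edist_dist, Real.dist_eq, ← mul_sub, abs_mul, abs_of_nonneg hL, ENNReal.ofReal_mul hL,
    ← Real.dist_eq, ← edist_dist]
  gcongr
  exact le_max_right _ _

lemma edist_projIcc_rpow_le (hT : 0 ≤ T) (hγ0 : 0 ≤ γ') (z w : ℝ × ℝ) :
    edist (projIcc 0 T hT z.1 : ℝ) (projIcc 0 T hT w.1) ^ γ' ≤ edist z w ^ γ' := by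
  gcongr
  refine le_trans ?_ (le_max_left _ _)
  have := LipschitzWith.projIcc hT z.1 w.1
  simpa [Subtype.edist_eq] using this

end Increments

/-! ### Moment bounds for the rescaled stochastic convolution -/

section StochConv

/-- The moments of order `q` of stochastic convolutions are bounded by `C` times the norms of the
frequency fields. -/
def IsMomentBound (q : ℝ≥0∞) (C : ℝ≥0) {Ω : Type*} [MeasurableSpace Ω] (P : Measure Ω) : Prop :=
  ∀ (W : ComplexCylindricalWiener P) (f : ℝ → ℝ → ℂ) (t x : ℝ) (Y : Ω → ℂ),
    IsStochConvAt W f t x Y → MemLp (freqField f t x) 2 (halfLine.prod volume) →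
    eLpNorm Y q P ≤ C * eLpNorm (freqField f t x) 2 (halfLine.prod volume) ∧
    ∀ (s y : ℝ) (Z : Ω → ℂ), IsStochConvAt W f s y Z →
      MemLp (freqField f s y) 2 (halfLine.prod volume) →
      eLpNorm (Y - Z) q P ≤
        C * eLpNorm (freqField f t x - freqField f s y) 2 (halfLine.prod volume)

variable {Ω : Type*} [MeasurableSpace Ω] {P : Measure Ω}
  {W : ComplexCylindricalWiener P} {f : ℝ → ℝ → ℂ} {q : ℝ≥0∞} {C : ℝ≥0} {γ γ' T L : ℝ}

lemma one_le_ofReal_rpow (hL : 1 ≤ L) (hγ0 : 0 ≤ γ') : 1 ≤ ENNReal.ofReal L ^ γ' :=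
  by simpa using ENNReal.rpow_le_rpow (ENNReal.one_le_ofReal.2 hL) hγ0

lemma eLpNorm_fixedTime_le (hC : IsMomentBound q C P)
    (hf : AEStronglyMeasurable (Function.uncurry f) ((volume.restrict (Icc 0 T)).prod volume))
    (hfin : normSqL2H γ T f < ∞) (hγ0 : 0 < γ') (hL : 1 ≤ L) {Ψ : ℝ → Ω → ℂ}
    (hΨ : ∀ x, IsStochConvAt W f T x (Ψ x)) (x : ℝ) :
    eLpNorm (Ψ x) q P ≤
      (C * 2 : ℝ≥0) * (ENNReal.ofReal L ^ γ' * normSqL2H γ T f ^ (1 / 2 : ℝ)) := by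
  refine (hC W f T x _ (hΨ x) (memLp_freqField hf hfin le_rfl x)).1.trans ?_
  refine (mul_le_mul_right (eLpNorm_freqField_le (γ := γ) hf le_rfl x) _).trans ?_
  rw [ENNReal.coe_mul, mul_assoc]
  gcongr
  rw [← mul_assoc]
  exact le_mul_of_one_le_left zero_le (one_le_mul (by norm_num) (one_le_ofReal_rpow hL hγ0.le))

/-- Space is rescaled by `L`, so the supremum over `[-L, L]` becomes one over `[-1, 1]`; the first
coordinate is a dummy that lets the planar criterion apply. -/
lemma eLpNorm_fixedTime_sub_le (hC : IsMomentBound q C P)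
    (hf : AEStronglyMeasurable (Function.uncurry f) ((volume.restrict (Icc 0 T)).prod volume))
    (hfin : normSqL2H γ T f < ∞) (hγ0 : 0 < γ') (hγ1 : γ' ≤ 1) (hγ : γ' ≤ γ) (hL : 1 ≤ L)
    {Ψ : ℝ → Ω → ℂ} (hΨ : ∀ x, IsStochConvAt W f T x (Ψ x)) (z w : ℝ × ℝ) :
    eLpNorm (Ψ (L * z.2) - Ψ (L * w.2)) q P ≤
      (C * 2 : ℝ≥0) * (ENNReal.ofReal L ^ γ' * normSqL2H γ T f ^ (1 / 2 : ℝ)) *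
        edist z w ^ γ' := by
  refine ((hC W f T _ _ (hΨ _) (memLp_freqField hf hfin le_rfl _)).2 T _ _ (hΨ _)
    (memLp_freqField hf hfin le_rfl _)).trans ?_
  calc (C : ℝ≥0∞) * eLpNorm (freqField f T (L * z.2) - freqField f T (L * w.2)) 2
        (halfLine.prod volume)
      ≤ C * (2 * (ENNReal.ofReal L ^ γ' * edist z w ^ γ') * normSqL2H γ T f ^ (1 / 2 : ℝ)) := by
        gcongr
        refine (eLpNorm_freqField_sub_space_le hf le_rfl hγ0 hγ1 hγ _ _).trans ?_
        gcongr
        exact edist_mul_left_rpow_le (by linarith) hγ0.le z w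
    _ = _ := by push_cast; ring

lemma eLpNorm_spaceTime_le (hC : IsMomentBound q C P)
    (hf : AEStronglyMeasurable (Function.uncurry f) ((volume.restrict (Icc 0 T)).prod volume))
    (hfin : normSqL2H γ T f + normSqK γ T f < ∞) (hγ0 : 0 < γ') (hL : 1 ≤ L)
    {Φ : ℝ → ℝ → Ω → ℂ} (hΦ : ∀ t ∈ Icc 0 T, ∀ x, IsStochConvAt W f t x (Φ t x)) {t : ℝ}
    (ht : t ∈ Icc 0 T) (x : ℝ) :
    eLpNorm (Φ t x) q P ≤ (C * (T.toNNReal ^ (γ - γ') + 2) : ℝ≥0) *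
      (ENNReal.ofReal L ^ γ' * (normSqL2H γ T f + normSqK γ T f) ^ (1 / 2 : ℝ)) := by
  have hfin' : normSqL2H γ T f < ∞ := le_self_add.trans_lt hfin
  refine (hC W f t x _ (hΦ t ht x) (memLp_freqField hf hfin' ht.2 x)).1.trans ?_
  refine (mul_le_mul_right (eLpNorm_freqField_le (γ := γ) hf ht.2 x) _).trans ?_
  rw [ENNReal.coe_mul, mul_assoc]
  gcongr
  rw [← mul_assoc]
  refine le_trans ?_ (le_mul_of_one_le_left zero_le (one_le_mul ?_ (one_le_ofReal_rpow hL hγ0.le)))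
  · gcongr
    exact le_self_add
  · rw [ENNReal.coe_add]
    exact le_add_left (by norm_num)

/-- Pass through the intermediate point `(s, L * z.2)`. Clamping time to `[0, T]` is 1-Lipschitz, so
the field extends to the whole plane with the same Hölder bound. -/
lemma eLpNorm_spaceTime_sub_le (hC : IsMomentBound q C P) (hq : 1 ≤ q)
    (hf : AEStronglyMeasurable (Function.uncurry f) ((volume.restrict (Icc 0 T)).prod volume))
    (hfin : normSqL2H γ T f + normSqK γ T f < ∞) (hT : 0 < T) (hγ0 : 0 < γ') (hγ1 : γ' ≤ 1)
    (hγ : γ' ≤ γ) (hL : 1 ≤ L) {Φ : ℝ → ℝ → Ω → ℂ}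
    (hΦ : ∀ t ∈ Icc 0 T, ∀ x, IsStochConvAt W f t x (Φ t x)) (z w : ℝ × ℝ) :
    eLpNorm (Φ (projIcc 0 T hT.le z.1) (L * z.2) - Φ (projIcc 0 T hT.le w.1) (L * w.2)) q P ≤
      (C * (T.toNNReal ^ (γ - γ') + 2) : ℝ≥0) *
      (ENNReal.ofReal L ^ γ' * (normSqL2H γ T f + normSqK γ T f) ^ (1 / 2 : ℝ)) *
        edist z w ^ γ' := by
  have hfin' : normSqL2H γ T f < ∞ := le_self_add.trans_lt hfin
  set t := projIcc 0 T hT.le z.1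
  set s := projIcc 0 T hT.le w.1
  set N := normSqL2H γ T f + normSqK γ T f
  have hm {r : ℝ} (hr : r ∈ Icc 0 T) (x : ℝ) := memLp_freqField hf hfin' hr.2 x
  have h1 : eLpNorm (Φ t (L * z.2) - Φ s (L * z.2)) q P ≤
      C * (ENNReal.ofReal T ^ (γ - γ') * edist z w ^ γ' * N ^ (1 / 2 : ℝ)) := by
    refine ((hC W f _ _ _ (hΦ _ t.2 _) (hm t.2 _)).2 _ _ _ (hΦ _ s.2 _) (hm s.2 _)).trans ?_
    gcongr
    refine (eLpNorm_freqField_sub_time_le hf s.2 t.2 hγ _).trans ?_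
    exact mul_le_mul' (mul_le_mul' le_rfl (edist_projIcc_rpow_le hT.le hγ0.le z w))
      (ENNReal.rpow_le_rpow le_add_self (by norm_num))
  have h2 : eLpNorm (Φ s (L * z.2) - Φ s (L * w.2)) q P ≤
      C * (2 * (ENNReal.ofReal L ^ γ' * edist z w ^ γ') * N ^ (1 / 2 : ℝ)) := by
    refine ((hC W f _ _ _ (hΦ _ s.2 _) (hm s.2 _)).2 _ _ _ (hΦ _ s.2 _) (hm s.2 _)).trans ?_
    gcongr
    refine (eLpNorm_freqField_sub_space_le hf s.2.2 hγ0 hγ1 hγ _ _).trans ?_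
    exact mul_le_mul' (mul_le_mul' le_rfl (edist_mul_left_rpow_le (by linarith) hγ0.le z w))
      (ENNReal.rpow_le_rpow le_self_add (by norm_num))
  rw [← sub_add_sub_cancel (Φ t (L * z.2)) (Φ s (L * z.2)) (Φ s (L * w.2))]
  have hmeas {r : ℝ} (hr : r ∈ Icc 0 T) (x : ℝ) : AEStronglyMeasurable (Φ r x) P :=
    (hΦ r hr x).1.1
  refine (eLpNorm_add_le ((hmeas t.2 _).sub (hmeas s.2 _)) ((hmeas s.2 _).sub (hmeas s.2 _))
    hq).trans ((add_le_add h1 h2).trans ?_)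
  have hT' : ENNReal.ofReal T ^ (γ - γ') = (T.toNNReal ^ (γ - γ') : ℝ≥0) := by
    rw [ENNReal.ofReal, ENNReal.coe_rpow_of_nonneg _ (sub_nonneg.2 hγ)]
  calc (C : ℝ≥0∞) * (ENNReal.ofReal T ^ (γ - γ') * edist z w ^ γ' * N ^ (1 / 2 : ℝ)) +
        C * (2 * (ENNReal.ofReal L ^ γ' * edist z w ^ γ') * N ^ (1 / 2 : ℝ))
      ≤ C * (ENNReal.ofReal T ^ (γ - γ') * (ENNReal.ofReal L ^ γ' * edist z w ^ γ') *
          N ^ (1 / 2 : ℝ)) +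
        C * (2 * (ENNReal.ofReal L ^ γ' * edist z w ^ γ') * N ^ (1 / 2 : ℝ)) := by
        gcongr
        -- The time increment carries no power of `L`; the harmless factor `L^γ' ≥ 1` gives both
        -- increments a common form.
        exact le_mul_of_one_le_left zero_le (one_le_ofReal_rpow hL hγ0.le)
    _ = _ := by
        rw [hT']
        push_cast
        ring

lemma mul_ofReal_rpow_mul_rpow_half_le {p : ℝ} (hp : 0 < p) (hγ : γ' ≤ γ) (hL : 1 ≤ L)
    (N : ℝ≥0∞) : C * (ENNReal.ofReal L ^ γ' * N ^ (1 / 2 : ℝ)) ^ p ≤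
      C * ENNReal.ofReal L ^ (γ * p) * N ^ (p / 2) := by
  rw [ENNReal.mul_rpow_of_nonneg _ _ hp.le, ← ENNReal.rpow_mul, ← ENNReal.rpow_mul,
    one_div_mul_eq_div, mul_assoc]
  gcongr
  simpa using hL

lemma mul_ofReal_rpow_mul_top_rpow {p a : ℝ} (hp : 0 < p) (hC : 0 < C) (hL : 1 ≤ L) :
    C * ENNReal.ofReal L ^ a * ∞ ^ (p / 2) = ∞ := by
  have hL0 : ENNReal.ofReal L ≠ 0 := by simpa using one_pos.trans_le hL
  rw [ENNReal.top_rpow_of_pos (by positivity)]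
  refine ENNReal.mul_top (mul_ne_zero (by exact_mod_cast hC.ne') ?_)
  exact (ENNReal.rpow_pos (pos_iff_ne_zero.2 hL0) ENNReal.ofReal_ne_top).ne'

end StochConv

/-! ### The theorem: fixed time and space-time -/

theorem mainTheorem3 (p γ : ℝ) (hp : 1 < p) (hγ : 1 / p < γ) :
    (∃ C : ℝ≥0, 0 < C ∧ ∀ T : ℝ, 0 < T →
      ∀ (Ω : Type*) [MeasurableSpace Ω] (P : Measure Ω) [IsProbabilityMeasure P]
        (W : ComplexCylindricalWiener P) (f : ℝ → ℝ → ℂ),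
        AEStronglyMeasurable (Function.uncurry f) ((volume.restrict (Icc 0 T)).prod volume) →
        (normSqL2H γ T f < ∞ → ∃ Ψ : ℝ → Ω → ℂ, IsContStochConvFixedTime W f T Ψ) ∧
        ∀ Ψ : ℝ → Ω → ℂ, IsContStochConvFixedTime W f T Ψ → ∀ L : ℝ, 1 ≤ L →
          ∫⁻ ω, (⨆ x ∈ Icc (-L) L, ‖Ψ x ω‖ₑ) ^ p ∂P ≤
            C * ENNReal.ofReal L ^ (γ * p) * normSqL2H γ T f ^ (p / 2)) ∧
    (∀ T : ℝ, 0 < T → ∃ C : ℝ≥0, 0 < C ∧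
      ∀ (Ω : Type*) [MeasurableSpace Ω] (P : Measure Ω) [IsProbabilityMeasure P]
        (W : ComplexCylindricalWiener P) (f : ℝ → ℝ → ℂ),
        AEStronglyMeasurable (Function.uncurry f) ((volume.restrict (Icc 0 T)).prod volume) →
        (normSqL2H γ T f + normSqK γ T f < ∞ → ∃ Φ : ℝ → ℝ → Ω → ℂ, IsContStochConv W f T Φ) ∧
        ∀ Φ : ℝ → ℝ → Ω → ℂ, IsContStochConv W f T Φ → ∀ L : ℝ, 1 ≤ L →
          ∫⁻ ω, (⨆ t ∈ Icc 0 T, ⨆ x ∈ Icc (-L) L, ‖Φ t x ω‖ₑ) ^ p ∂P ≤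
            C * ENNReal.ofReal L ^ (p * γ) * (normSqL2H γ T f + normSqK γ T f) ^ (p / 2)) := by
  have hp0 : 0 < p := one_pos.trans hp
  have hγ0 : 0 < γ := (one_div_pos.2 hp0).trans hγ
  -- The interpolation bound for characters requires a Hölder exponent at most one.
  obtain ⟨γ', hγ'0, hγ'1, hγ'⟩ : ∃ γ' : ℝ, 0 < γ' ∧ γ' ≤ 1 ∧ γ' ≤ γ :=
    ⟨min γ 1, lt_min hγ0 one_pos, min_le_right _ _, min_le_left _ _⟩
  -- Gaussian moments of every finite order are available, so `q` may be taken large enough for the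
  -- two-dimensional criterion.
  obtain ⟨q, hpq, hγq⟩ : ∃ q : ℝ, p ≤ q ∧ 2 < γ' * q := by
    refine ⟨max p (3 / γ'), le_max_left _ _, ?_⟩
    calc (2 : ℝ) < γ' * (3 / γ') := by rw [mul_div_cancel₀ _ hγ'0.ne']; norm_num
      _ ≤ _ := by gcongr; exact le_max_right _ _
  have hq0 : 0 < q := hp0.trans_le hpq
  have hq1 : 1 ≤ ENNReal.ofReal q := by simpa using hp.le.trans hpq
  refine ⟨?_, fun T hT => ?_⟩
  · obtain ⟨D, hD⟩ := exists_eLpNorm_stochConv_le (ENNReal.ofReal q) ENNReal.ofReal_ne_top hq1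
    obtain ⟨C, hC0, hC⟩ := exists_lintegral_sup_rpow_le hp hpq hγ'0 hγq 1 (D * 2)
    refine ⟨C, hC0, fun T hT Ω _ P _ W f hf => ⟨fun hfin => ?_, fun Ψ hΨ L hL => ?_⟩⟩
    · choose Ψ hΨ using fun x : ℝ => exists_isStochConvAt W hT.le (memLp_freqField hf hfin le_rfl x)
      -- Existence needs no rescaling, so the increment estimate is used with `L = 1`.
      obtain ⟨Y, hYc, hY⟩ := exists_continuous_modification (P := P)
        (X := fun z => Ψ (1 * z.2)) hq0 hγ'0 hγq
        (A := (D * 2 : ℝ≥0) * (ENNReal.ofReal 1 ^ γ' * normSqL2H γ T f ^ (1 / 2 : ℝ)))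
        (ENNReal.mul_ne_top ENNReal.coe_ne_top (ENNReal.mul_ne_top (by simp)
          (ENNReal.rpow_ne_top_of_nonneg (by norm_num) hfin.ne)))
        (fun z => (hΨ _).1.1.aemeasurable) fun z w => by
          rw [lintegral_edist_rpow_eq hq0]
          exact ENNReal.rpow_le_rpow
            (eLpNorm_fixedTime_sub_le (hD P) hf hfin hγ'0 hγ'1 hγ' le_rfl hΨ z w) hq0.le
      refine ⟨fun x => Y (0, x), fun x => (hΨ x).congr ?_, ?_⟩
      · simpa using (hY (0, x)).symm
      · filter_upwards [hYc] with ω hω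
        exact hω.comp (by fun_prop : Continuous fun x : ℝ => ((0, x) : ℝ × ℝ))
    · rcases eq_top_or_lt_top (normSqL2H γ T f) with htop | hfin
      · rw [htop, mul_ofReal_rpow_mul_top_rpow hp0 hC0 hL]
        exact le_top
      refine le_trans (lintegral_mono fun ω => ?_) ((hC P (fun z => Ψ (L * z.2))
        (ENNReal.ofReal L ^ γ' * normSqL2H γ T f ^ (1 / 2 : ℝ)) (fun z => (hΨ.version _).1.1)
        ?_ (eLpNorm_fixedTime_le (hD P) hf hfin hγ'0 hL hΨ.version _)
        (eLpNorm_fixedTime_sub_le (hD P) hf hfin hγ'0 hγ'1 hγ' hL hΨ.version)).trans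
        (mul_ofReal_rpow_mul_rpow_half_le hp0 hγ' hL _))
      · gcongr
        refine iSup₂_le fun x hx => le_iSup₂_of_le (0, x / L) ⟨by simp, ?_⟩ ?_
        · rw [abs_div, abs_of_pos (one_pos.trans_le hL), Nat.cast_one]
          exact div_le_one_of_le₀ (abs_le.2 hx) (by linarith)
        · rw [mul_div_cancel₀ _ (by linarith : L ≠ 0)]
      · filter_upwards [hΨ.cont] with ω hω
        exact hω.comp (by fun_prop : Continuous fun z : ℝ × ℝ => L * z.2)
  · obtain ⟨D, hD⟩ := exists_eLpNorm_stochConv_le (ENNReal.ofReal q) ENNReal.ofReal_ne_top hq1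
    -- The box `[-N, N]²` must contain `[0, T] × [-1, 1]`; this depends on `T` but not on `L`.
    obtain ⟨N, hN⟩ := exists_nat_ge (max T 1)
    obtain ⟨C, hC0, hC⟩ := exists_lintegral_sup_rpow_le hp hpq hγ'0 hγq N
      (D * (T.toNNReal ^ (γ - γ') + 2))
    refine ⟨C, hC0, fun Ω _ P _ W f hf => ⟨fun hfin => ?_, fun Φ hΦ L hL => ?_⟩⟩
    · have hex (t x : ℝ) : ∃ Y : Ω → ℂ, t ∈ Icc 0 T → IsStochConvAt W f t x Y := by
        by_cases ht : t ∈ Icc 0 T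
        · obtain ⟨Y, hY⟩ := exists_isStochConvAt W ht.1
            (memLp_freqField hf (le_self_add.trans_lt hfin) ht.2 x)
          exact ⟨Y, fun _ => hY⟩
        · exact ⟨0, fun h => absurd h ht⟩
      choose Φ hΦ using hex
      have hΦ' : ∀ t ∈ Icc 0 T, ∀ x, IsStochConvAt W f t x (Φ t x) := fun t ht x => hΦ t x ht
      obtain ⟨Y, hYc, hY⟩ := exists_continuous_modification (P := P)
        (X := fun z => Φ (projIcc 0 T hT.le z.1) (1 * z.2)) hq0 hγ'0 hγq
        (A := (D * (T.toNNReal ^ (γ - γ') + 2) : ℝ≥0) *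
          (ENNReal.ofReal 1 ^ γ' * (normSqL2H γ T f + normSqK γ T f) ^ (1 / 2 : ℝ)))
        (ENNReal.mul_ne_top ENNReal.coe_ne_top (ENNReal.mul_ne_top (by simp)
          (ENNReal.rpow_ne_top_of_nonneg (by norm_num) hfin.ne)))
        (fun z => (hΦ _ _ (projIcc 0 T hT.le z.1).2).1.1.aemeasurable) fun z w => by
          rw [lintegral_edist_rpow_eq hq0]
          exact ENNReal.rpow_le_rpow
            (eLpNorm_spaceTime_sub_le (hD P) hq1 hf hfin hT hγ'0 hγ'1 hγ' le_rfl hΦ' z w) hq0.le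
      refine ⟨fun t x => Y (t, x), fun t ht x => (hΦ t x ht).congr ?_, ?_⟩
      · simpa [projIcc_of_mem hT.le ht] using (hY (t, x)).symm
      · filter_upwards [hYc] with ω hω
        exact hω.continuousOn
    · rcases eq_top_or_lt_top (normSqL2H γ T f + normSqK γ T f) with htop | hfin
      · rw [htop, mul_ofReal_rpow_mul_top_rpow hp0 hC0 hL]
        exact le_top
      rw [mul_comm p γ]
      refine le_trans (lintegral_mono fun ω => ?_) ((hC P
        (fun z => Φ (projIcc 0 T hT.le z.1) (L * z.2))
        (ENNReal.ofReal L ^ γ' * (normSqL2H γ T f + normSqK γ T f) ^ (1 / 2 : ℝ))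
        (fun z => (hΦ.version _ (projIcc 0 T hT.le z.1).2 _).1.1)
        ?_ (eLpNorm_spaceTime_le (hD P) hf hfin hγ'0 hL hΦ.version (projIcc 0 T hT.le _).2 _)
        (eLpNorm_spaceTime_sub_le (hD P) hq1 hf hfin hT hγ'0 hγ'1 hγ' hL hΦ.version)).trans
        (mul_ofReal_rpow_mul_rpow_half_le hp0 hγ' hL _))
      · gcongr
        -- The point `(t, x / L)` lies in the box, and the clamped, rescaled field takes the value
        -- `Φ t x` there.
        refine iSup₂_le fun t ht => iSup₂_le fun x hx =>
          le_iSup₂_of_le (t, x / L) ⟨?_, ?_⟩ ?_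
        · rw [abs_of_nonneg ht.1]
          exact ht.2.trans ((le_max_left _ _).trans hN)
        · rw [abs_div, abs_of_pos (one_pos.trans_le hL)]
          exact (div_le_one_of_le₀ (abs_le.2 hx) (by linarith)).trans ((le_max_right _ _).trans hN)
        · rw [mul_div_cancel₀ _ (by linarith : L ≠ 0), projIcc_of_mem hT.le ht]
      · filter_upwards [hΦ.cont] with ω hω
        exact hω.comp_continuous
          (by fun_prop : Continuous fun z : ℝ × ℝ => ((projIcc 0 T hT.le z.1 : ℝ), L * z.2))
          fun z => ⟨(projIcc 0 T hT.le z.1).2, mem_univ _⟩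

end
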